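/- Let $\Omega\subseteq\mathbb{R}^2$ be open, let $\bm u=(u,v)^{\mathrm T}:\Omega\to\mathbb{R}^2$ be a bivariate planar image of class $C^2$, and let $\bm x\in\Omega$ be a location with $\det \mathrm{D}\bm u(\bm x)\neq 0$. For $\varrho>0$ let $D_\varrho(\bm x)$ be the disc of radius $\varrho$ around $\bm x$. One step of $L^1$ median filtering with structuring element $D_\varrho$ replaces $\bm u(\bm x)$ by a minimiser $\bm m_\varrho$ of $$\bm m\mapsto\int_{D_\varrho(\bm x)}\lvert\bm u(\bm y)-\bm m\rvert\,\mathrm d\bm y,\qquad \bm m\in\mathbb{R}^2 .$$ Let $\bm\eta,\bm\xi$ be orthonormal eigenvectors of the structure tensor $\bm J=\mathrm{D}\bm u^{\mathrm T}\mathrm{D}\bm u$ at $\bm x$, where $\bm\eta$ is the major eigenvector (belonging to the larger eigenvalue) and $\bm\xi$ the minor one; put $\bm P=(\bm\eta\,|\,\bm\xi)$ and $$\bm R=(\mathrm{D}\bm u^{-1})^{\mathrm T}\,\bm P\,\mathrm{diag}(\lvert\partial_{\bm\eta}\bm u\rvert,\lvert\partial_{\bm\xi}\bm u\rvert),\qquad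 \lambda=\frac{\lvert\partial_{\bm\eta}\bm u\rvert}{\lvert\partial_{\bm\xi}\bm u\rvert}.$$ For $\lambda\in(0,\infty)$ define $$Q_1(\lambda)=\frac{3\iint_{D_1(\bm 0)} s^2t^2/(s^2+\lambda^2t^2)^{3/2}\,\mathrm ds\,\mathrm dt}{\iint_{D_1(\bm 0)} s^2/(s^2+\lambda^2t^2)^{3/2}\,\mathrm ds\,\mathrm dt},\qquad Q_2(\lambda)=\frac{3\iint_{D_1(\bm 0)} t^4/(s^2+\lambda^2t^2)^{3/2}\,\mathrm ds\,\mathrm dt}{\iint_{D_1(\bm 0)} t^2/(s^2+\lambda^2t^2)^{3/2}\,\mathrm ds\,\mathrm dt},$$ and $Q_1(0)=Q_2(0)=1$, $Q_1(\infty)=Q_2(\infty)=0$. Then: 1. For every $\lambda\in(0,\infty)$ the four integrals converge and the two denominators are positive; the values of $Q_1,Q_2$ at $0$ and $\infty$ are their limits there. 2. $\bm R$ is an orthogonal matrix with $\det\bm R=\operatorname{sgn}(\det\mathrm{D}\bm u)\det\bm P$ (so it is a rotation whenever the signs of $\bm\eta,\bm\xi$ are chosen such that $\det \bm P$ has the sign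 of $\det\mathrm{D}\bm u$). 3. For all sufficiently small $\varrho>0$ the median $\bm m_\varrho$ exists and is unique, and one step of $L^1$ median filtering approximates for $\varrho\to0$ an explicit time step of size $\tau=\varrho^2/6$ of the PDE system $$\bm u_t=\bm S\,\bm u_{\bm\eta\bm\eta}+\bm T\,\bm u_{\bm\xi\bm\xi}-2\,\bm W\,\bm u_{\bm\xi\bm\eta},$$ that is, $$\bm m_\varrho=\bm u(\bm x)+\frac{\varrho^2}{6}\bigl(\bm S\,\bm u_{\bm\eta\bm\eta}(\bm x)+\bm T\,\bm u_{\bm\xi\bm\xi}(\bm x)-2\,\bm W\,\bm u_{\bm\xi\bm\eta}(\bm x)\bigr)+o(\varrho^2)\qquad(\varrho\to0^+),$$ where $$\bm S=\bm R\,\mathrm{diag}\bigl(Q_1(\lambda),Q_2(\lambda)\bigr)\bm R^{\mathrm T},\qquad \bm T=\bm R\,\mathrm{diag}\bigl(Q_2(\lambda^{-1}),Q_1(\lambda^{-1})\bigr)\bm R^{\mathrm T},$$ $$\bm W=\bm R\begin{pmatrix}0&\lambda\,Q_1(\lambda)\\ \lambda^{-1}Q_1(\lambda^{-1})&0\end{pmatrix}\bm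 R^{\mathrm T}.$$ -/

import Mathlib

open MeasureTheory Filter Topology Asymptotics
open scoped Matrix ENNReal

/-- The Euclidean plane, used both as image plane and as value plane. -/
abbrev Plane : Type := EuclideanSpace ℝ (Fin 2)

/-- `m` is an `L¹` median of the values of `u` in the disc `D_ρ(x)`: it minimises the integral
of the distances to these values, the arguments being uniformly distributed in the disc. -/
def IsL1MedianOnDisc (u : Plane → Plane) (x : Plane) (ρ : ℝ) (m : Plane) : Prop :=
  ∀ m' : Plane,
    ∫ y in Metric.closedBall x ρ, ‖u y - m‖ ≤ ∫ y in Metric.closedBall x ρ, ‖u y - m'‖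

/-- The integrand `s^i t^j / (s² + l² t²)^(3/2)` at the point `p = (s, t)`. -/
noncomputable def ellipticIntegrand (i j : ℕ) (l : ℝ) (p : Plane) : ℝ :=
  p 0 ^ i * p 1 ^ j / (p 0 ^ 2 + l ^ 2 * p 1 ^ 2) ^ (3 / 2 : ℝ)

/-- The integral of `s^i t^j / (s² + l² t²)^(3/2)` over the unit disc. -/
noncomputable def ellipticIntegral (i j : ℕ) (l : ℝ) : ℝ :=
  ∫ p in Metric.closedBall (0 : Plane) 1, ellipticIntegrand i j l p

/-- The coefficient function `Q₁` on `[0, ∞]`. -/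
noncomputable def coeffQ₁ (l : ℝ≥0∞) : ℝ :=
  if l = 0 then 1
  else if l = ∞ then 0
  else 3 * ellipticIntegral 2 2 l.toReal / ellipticIntegral 2 0 l.toReal

/-- The coefficient function `Q₂` on `[0, ∞]`. -/
noncomputable def coeffQ₂ (l : ℝ≥0∞) : ℝ :=
  if l = 0 then 1
  else if l = ∞ then 0
  else 3 * ellipticIntegral 0 4 l.toReal / ellipticIntegral 0 2 l.toReal

/-- The directional derivative `∂_a u`. -/
noncomputable def dirDeriv (a : Plane) (u : Plane → Plane) (x : Plane) : Plane :=
  fderiv ℝ u x a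

/-- The second directional derivative `∂_b ∂_a u`, also written `u_ab`. -/
noncomputable def dirDeriv₂ (a b : Plane) (u : Plane → Plane) (x : Plane) : Plane :=
  dirDeriv b (dirDeriv a u) x

/-- The Jacobian matrix `Du`, with rows `(u_x, u_y)` and `(v_x, v_y)`. -/
noncomputable def jacobianMatrix (u : Plane → Plane) (x : Plane) : Matrix (Fin 2) (Fin 2) ℝ :=
  Matrix.of fun i j => dirDeriv (EuclideanSpace.single j 1) u x i

/-- The structure tensor `J = Duᵀ Du`. -/
noncomputable def structureTensor (u : Plane → Plane) (x : Plane) :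
    Matrix (Fin 2) (Fin 2) ℝ :=
  (jacobianMatrix u x)ᵀ * jacobianMatrix u x

/-- `η` and `ξ` are orthonormal eigenvectors of `J`, `η` being the major one (for the larger
eigenvalue) and `ξ` the minor one. -/
structure IsMajorMinorEigenframe (J : Matrix (Fin 2) (Fin 2) ℝ) (η ξ : Plane) : Prop where
  norm_major : ‖η‖ = 1
  norm_minor : ‖ξ‖ = 1
  orthogonal : inner ℝ η ξ = 0
  eigen : ∃ μ₁ μ₂ : ℝ, μ₂ ≤ μ₁ ∧ J *ᵥ η.ofLp = μ₁ • η.ofLp ∧ J *ᵥ ξ.ofLp = μ₂ • ξ.ofLp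

/-- The eigenvector matrix `P = (η | ξ)`, with columns `η` and `ξ`. -/
def frameMatrix (η ξ : Plane) : Matrix (Fin 2) (Fin 2) ℝ :=
  !![η 0, ξ 0; η 1, ξ 1]

/-- `R = (Du⁻¹)ᵀ P diag(|∂_η u|, |∂_ξ u|)`. -/
noncomputable def rotationR (u : Plane → Plane) (η ξ x : Plane) : Matrix (Fin 2) (Fin 2) ℝ :=
  ((jacobianMatrix u x)⁻¹)ᵀ * frameMatrix η ξ *
    Matrix.diagonal ![‖dirDeriv η u x‖, ‖dirDeriv ξ u x‖]

/-- The ratio `|∂_a u| / |∂_b u|`. -/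
noncomputable def derivRatio (u : Plane → Plane) (a b x : Plane) : ℝ :=
  ‖dirDeriv a u x‖ / ‖dirDeriv b u x‖

/-- The coefficient matrix `S(Du)`. -/
noncomputable def coeffS (u : Plane → Plane) (η ξ x : Plane) : Matrix (Fin 2) (Fin 2) ℝ :=
  rotationR u η ξ x *
    Matrix.diagonal ![coeffQ₁ (ENNReal.ofReal (derivRatio u η ξ x)),
      coeffQ₂ (ENNReal.ofReal (derivRatio u η ξ x))] *
    (rotationR u η ξ x)ᵀ

/-- The coefficient matrix `T(Du)`. -/
noncomputable def coeffT (u : Plane → Plane) (η ξ x : Plane) : Matrix (Fin 2) (Fin 2) ℝ :=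
  rotationR u η ξ x *
    Matrix.diagonal ![coeffQ₂ (ENNReal.ofReal (derivRatio u ξ η x)),
      coeffQ₁ (ENNReal.ofReal (derivRatio u ξ η x))] *
    (rotationR u η ξ x)ᵀ

/-- The coefficient matrix `W(Du)`. -/
noncomputable def coeffW (u : Plane → Plane) (η ξ x : Plane) : Matrix (Fin 2) (Fin 2) ℝ :=
  rotationR u η ξ x *
    !![0, derivRatio u η ξ x * coeffQ₁ (ENNReal.ofReal (derivRatio u η ξ x));
       derivRatio u ξ η x * coeffQ₁ (ENNReal.ofReal (derivRatio u ξ η x)), 0] *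
    (rotationR u η ξ x)ᵀ

/-- The right-hand side `S u_ηη + T u_ξξ - 2 W u_ξη` of the PDE system at the point `x`. -/
noncomputable def medianPdeRhs (u : Plane → Plane) (η ξ x : Plane) : Plane :=
  WithLp.toLp 2
    (coeffS u η ξ x *ᵥ (dirDeriv₂ η η u x).ofLp
      + coeffT u η ξ x *ᵥ (dirDeriv₂ ξ ξ u x).ofLp
      - (2 : ℝ) • (coeffW u η ξ x *ᵥ (dirDeriv₂ ξ η u x).ofLp))

/-! ### Elliptic integrals over the unit disc -/

/-! Write `A` for the derivative and `B` for the second derivative of `u` at `x`. With `y = x + ρ z`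
and the ansatz `m = u x + ρ² c`, the distance `‖u y - m‖` is `ρ ‖A z + ρ (h_ρ z - c)‖`, where `h_ρ`
tends uniformly on the unit disc to `½ B z z`. Expand the norm at `A z`. The zeroth order term does
not involve `c`, and the first order term in `c` is odd in `z` and integrates to zero. The
dependence on `c` therefore starts at second order, and up to a constant the functional is `ρ⁵`
times a convex functional of `c` (`exists_medianFunctional_eq`).

As `ρ → 0` these functionals converge, jointly in `ρ` and `c`, to the integral of the second order
term of the norm (`tendsto_scaledMedianFunctional`). That term is singular only at `z = 0` and is
dominated by a multiple of `‖z‖⁻¹`, which is integrable in the plane; this is where invertibility of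
`A` enters. By convexity, minimisers converge to the strict minimiser of the limit
(`tendsto_minimizer_of_convexOn`).

The limit is quadratic in `c`. The vectors `∂_η u` and `∂_ξ u` are orthogonal, so in the frame of
their normalisations, which are the columns of `R`, the integrand is an explicit expression with
denominator `(s² + l² t²)^(3/2)`, `l = λ⁻¹` (`limitMedianFunctional_eq`). Integrals odd in `t`
vanish, the stationarity equations decouple, and their solution is one sixth of the right-hand side
of the PDE system (`integral_quadraticIntegrand_add`,
`IsMajorMinorEigenframe.limitMedianFunctional_lt`).

Existence of medians is coercivity. For uniqueness, two different medians would force the values of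
`u` onto a line, which an invertible derivative excludes. The limits of `Q₁` come from polar
coordinates, those of `Q₂` from the relation `Q₂(l) = 1 - Q₁(l⁻¹)`. -/

lemma rpow_three_halves {d : ℝ} (hd : 0 ≤ d) : d ^ (3 / 2 : ℝ) = √d ^ 3 := by
  rw [Real.sqrt_eq_rpow, ← Real.rpow_natCast, ← Real.rpow_mul hd]
  norm_num

lemma Plane.norm_sq (p : Plane) : ‖p‖ ^ 2 = p 0 ^ 2 + p 1 ^ 2 := by
  simp [EuclideanSpace.norm_sq_eq, Fin.sum_univ_two]

lemma Plane.inner_eq (p q : Plane) : inner ℝ p q = p 0 * q 0 + p 1 * q 1 := by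
  simp [PiLp.inner_apply, Fin.sum_univ_two, mul_comm]

lemma Plane.abs_apply_le_norm (p : Plane) (i : Fin 2) : |p i| ≤ ‖p‖ :=
  PiLp.norm_apply_le p i

lemma integrableOn_inv_norm_closedBall :
    IntegrableOn (fun p : Plane => ‖p‖⁻¹) (Metric.closedBall 0 1) := by
  have h : IntegrableOn (fun p : Plane => ‖p‖⁻¹) (Metric.ball 0 2) := by
    rw [integrableOn_fun_norm_addHaar (μ := (volume : Measure Plane)) (f := fun r => r⁻¹)]
    have : IntegrableOn (fun _ : ℝ => (1 : ℝ)) (Set.Ioo 0 2) := by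
      simp
    refine this.congr_fun (fun y hy => ?_) measurableSet_Ioo
    have : y ≠ 0 := hy.1.ne'
    simp [this]
  exact h.mono_set (Metric.closedBall_subset_ball (by norm_num))

lemma integrableOn_of_norm_le_inv_norm {f : Plane → ℝ} (hf : Measurable f) {C : ℝ}
    (h : ∀ p ∈ Metric.closedBall (0 : Plane) 1, |f p| ≤ C * ‖p‖⁻¹) :
    IntegrableOn f (Metric.closedBall 0 1) := by
  refine Integrable.mono' (integrableOn_inv_norm_closedBall.const_mul C)
    hf.aestronglyMeasurable ?_
  filter_upwards [ae_restrict_mem Metric.isClosed_closedBall.measurableSet] with p hp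
  exact h p hp

lemma measurable_ellipticIntegrand (i j : ℕ) (l : ℝ) : Measurable (ellipticIntegrand i j l) := by
  unfold ellipticIntegrand
  fun_prop

/-- The integrand is homogeneous of degree `i + j - 3 ≥ -1`, hence bounded on the unit disc by a
multiple of `‖p‖⁻¹`. -/
lemma integrableOn_ellipticIntegrand {i j : ℕ} (hij : 2 ≤ i + j) {l : ℝ} (hl : 0 < l) :
    IntegrableOn (ellipticIntegrand i j l) (Metric.closedBall (0 : Plane) 1) := by
  -- This is the ellipticity constant: `k² ‖p‖² ≤ s² + l² t²`.
  set k := min 1 l with hk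
  have hk0 : 0 < k := lt_min one_pos hl
  have hk1 : k ^ 2 ≤ 1 := by nlinarith [min_le_left 1 l]
  have hkl : k ^ 2 ≤ l ^ 2 := by nlinarith [min_le_right 1 l]
  refine integrableOn_of_norm_le_inv_norm (measurable_ellipticIntegrand i j l) (C := (k ^ 3)⁻¹)
    fun p hp => ?_
  rw [mem_closedBall_zero_iff] at hp
  rcases eq_or_ne p 0 with rfl | hp0
  · have : ellipticIntegrand i j l 0 = 0 := by simp [ellipticIntegrand]
    simp [this]
  have hn : 0 < ‖p‖ := norm_pos_iff.2 hp0
  have hd : (k * ‖p‖) ^ 2 ≤ p 0 ^ 2 + l ^ 2 * p 1 ^ 2 := by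
    rw [mul_pow, Plane.norm_sq]
    nlinarith [sq_nonneg (p 0), sq_nonneg (p 1)]
  have hs : k * ‖p‖ ≤ √(p 0 ^ 2 + l ^ 2 * p 1 ^ 2) := Real.le_sqrt_of_sq_le hd
  rw [ellipticIntegrand, rpow_three_halves (by positivity), abs_div, abs_mul, abs_pow, abs_pow,
    abs_of_nonneg (by positivity : 0 ≤ √(p 0 ^ 2 + l ^ 2 * p 1 ^ 2) ^ 3)]
  have hnum : |p 0| ^ i * |p 1| ^ j ≤ ‖p‖ ^ 2 := by
    calc |p 0| ^ i * |p 1| ^ j ≤ ‖p‖ ^ i * ‖p‖ ^ j := by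
          gcongr <;> exact Plane.abs_apply_le_norm p _
      _ = ‖p‖ ^ (i + j) := (pow_add _ _ _).symm
      _ ≤ ‖p‖ ^ 2 := pow_le_pow_of_le_one hn.le hp hij
  calc |p 0| ^ i * |p 1| ^ j / √(p 0 ^ 2 + l ^ 2 * p 1 ^ 2) ^ 3
      ≤ ‖p‖ ^ 2 / (k * ‖p‖) ^ 3 := by gcongr
    _ = (k ^ 3)⁻¹ * ‖p‖⁻¹ := by field_simp

/-- The angular part of `ellipticIntegrand`. -/
noncomputable def angularIntegrand (i j : ℕ) (l θ : ℝ) : ℝ :=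
  Real.cos θ ^ i * Real.sin θ ^ j / √(Real.cos θ ^ 2 + l ^ 2 * Real.sin θ ^ 2) ^ 3

/-- The integral of the angular part of `ellipticIntegrand` over the full circle. -/
noncomputable def angularIntegral (i j : ℕ) (l : ℝ) : ℝ :=
  ∫ θ in Set.Ioo (-Real.pi) Real.pi, angularIntegrand i j l θ

lemma integral_plane_eq_integral_prod (f : Plane → ℝ) :
    ∫ p, f p = ∫ q : ℝ × ℝ, f !₂[q.1, q.2] := by
  have h1 := ((EuclideanSpace.volume_preserving_symm_measurableEquiv_toLp (Fin 2)).trans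
    (volume_preserving_finTwoArrow ℝ)).symm ((MeasurableEquiv.toLp 2 (Fin 2 → ℝ)).symm.trans
      MeasurableEquiv.finTwoArrow)
  rw [← h1.integral_comp' (g := f)]
  rfl

/-- In polar coordinates the integrand splits; the radial factor, with the Jacobian, is `r ^ (i + j
- 2)`. The factors `1/3` and `1` that arise for `i + j = 4` and `i + j = 2` absorb the `3` in `Q₁`
and `Q₂`. -/
lemma ellipticIntegral_eq_angularIntegral (i j : ℕ) (hij : 2 ≤ i + j) (l : ℝ) :
    ellipticIntegral i j l = ((i + j - 1 : ℕ) : ℝ)⁻¹ * angularIntegral i j l := by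
  rw [ellipticIntegral, ← integral_indicator Metric.isClosed_closedBall.measurableSet,
    integral_plane_eq_integral_prod, ← integral_comp_polarCoord_symm, polarCoord_target]
  have key : ∀ q ∈ Set.Ioi (0 : ℝ) ×ˢ Set.Ioo (-Real.pi) Real.pi,
      q.1 • (Metric.closedBall (0 : Plane) 1).indicator (ellipticIntegrand i j l)
        !₂[(polarCoord.symm q).1, (polarCoord.symm q).2]
      = (Set.Iic 1).indicator (fun r : ℝ => r ^ (i + j - 2)) q.1 * angularIntegrand i j l q.2 := by
    rintro ⟨r, θ⟩ ⟨hr, -⟩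
    rw [Set.mem_Ioi] at hr
    simp only [polarCoord_symm_apply, smul_eq_mul]
    have hnorm : ‖(!₂[r * Real.cos θ, r * Real.sin θ] : Plane)‖ = r := by
      rw [← sq_eq_sq₀ (norm_nonneg _) hr.le, Plane.norm_sq]
      simp only [Matrix.cons_val_zero, Matrix.cons_val_one]
      linear_combination r ^ 2 * Real.sin_sq_add_cos_sq θ
    by_cases h1 : r ≤ 1
    · rw [Set.indicator_of_mem (by rw [mem_closedBall_zero_iff, hnorm]; exact h1),
        Set.indicator_of_mem (Set.mem_Iic.2 h1), ellipticIntegrand, angularIntegrand,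
        rpow_three_halves (by positivity)]
      simp only [Matrix.cons_val_zero, Matrix.cons_val_one]
      have : √((r * Real.cos θ) ^ 2 + l ^ 2 * (r * Real.sin θ) ^ 2)
          = r * √(Real.cos θ ^ 2 + l ^ 2 * Real.sin θ ^ 2) := by
        rw [show (r * Real.cos θ) ^ 2 + l ^ 2 * (r * Real.sin θ) ^ 2
          = r ^ 2 * (Real.cos θ ^ 2 + l ^ 2 * Real.sin θ ^ 2) by ring,
          Real.sqrt_mul (sq_nonneg r), Real.sqrt_sq hr.le]
      rw [this]
      have hpow : r ^ i * r ^ j = r ^ 2 * r ^ (i + j - 2) := by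
        rw [← pow_add, ← pow_add]; congr 1; omega
      rw [mul_pow r, mul_pow r, mul_pow r, show r ^ i * Real.cos θ ^ i * (r ^ j * Real.sin θ ^ j)
        = r ^ 2 * r ^ (i + j - 2) * (Real.cos θ ^ i * Real.sin θ ^ j) by rw [← hpow]; ring]
      -- As `l` is arbitrary, the root may vanish; both quotients then have the default value `0`.
      by_cases hz : √(Real.cos θ ^ 2 + l ^ 2 * Real.sin θ ^ 2) = 0
      · simp [hz]
      · field_simp
    · rw [Set.indicator_of_notMem (by rw [mem_closedBall_zero_iff, hnorm]; exact h1),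
        Set.indicator_of_notMem (by simpa using h1)]
      simp
  rw [setIntegral_congr_fun (measurableSet_Ioi.prod measurableSet_Ioo) key, Measure.volume_eq_prod,
    setIntegral_prod_mul, angularIntegral]
  congr 1
  rw [setIntegral_indicator measurableSet_Iic, Set.Ioi_inter_Iic,
    ← intervalIntegral.integral_of_le zero_le_one, integral_pow]
  have : i + j - 1 = i + j - 2 + 1 := by omega
  rw [this]
  simp

lemma cos_sq_add_mul_sin_sq_pos {l : ℝ} (hl : 0 < l) (θ : ℝ) :
    0 < Real.cos θ ^ 2 + l ^ 2 * Real.sin θ ^ 2 := by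
  rcases eq_or_ne (Real.sin θ) 0 with h | h
  · have := Real.sin_sq_add_cos_sq θ
    rw [h] at this ⊢
    nlinarith
  · positivity

lemma angularIntegrand_nonneg (i j : ℕ) (hi : Even i) (hj : Even j) (l θ : ℝ) :
    0 ≤ angularIntegrand i j l θ := by
  have := hi.pow_nonneg (Real.cos θ)
  have := hj.pow_nonneg (Real.sin θ)
  unfold angularIntegrand
  positivity

lemma integrableOn_angularIntegrand (i j : ℕ) {l : ℝ} (hl : 0 < l) :
    IntegrableOn (angularIntegrand i j l) (Set.Ioo (-Real.pi) Real.pi) := by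
  have hc : Continuous (angularIntegrand i j l) := by
    unfold angularIntegrand
    refine Continuous.div (by fun_prop) (by fun_prop) fun θ => ?_
    have := Real.sqrt_pos.2 (cos_sq_add_mul_sin_sq_pos hl θ)
    positivity
  exact hc.integrableOn_Icc.mono_set Set.Ioo_subset_Icc_self

/-! ### Bounds for the angular integrals and the limits of their quotient -/

lemma angularIntegral_22_add_40 {l : ℝ} (hl : 0 < l) :
    angularIntegral 2 2 l + angularIntegral 4 0 l = angularIntegral 2 0 l := by
  rw [angularIntegral, angularIntegral, ← integral_add (integrableOn_angularIntegrand 2 2 hl)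
    (integrableOn_angularIntegrand 4 0 hl), angularIntegral]
  congr 1
  ext θ
  simp only [angularIntegrand]
  rw [← add_div]
  congr 1
  linear_combination Real.cos θ ^ 2 * Real.sin_sq_add_cos_sq θ

lemma angularIntegral_le (i j : ℕ) {l C : ℝ} (hl : 0 < l)
    (h : ∀ θ, angularIntegrand i j l θ ≤ C) : angularIntegral i j l ≤ 2 * Real.pi * C := by
  have : ∫ _ in Set.Ioo (-Real.pi) Real.pi, C = 2 * Real.pi * C := by
    have : (0 : ℝ) ≤ Real.pi + Real.pi := by positivity
    simp [this, two_mul]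
  rw [← this]
  exact setIntegral_mono (integrableOn_angularIntegrand i j hl) (by simp) h

/-- The integrand is nonnegative, so a minorant on part of the circle suffices. -/
lemma le_angularIntegral_20 {l b : ℝ} {g : ℝ → ℝ} (hl : 0 < l) (hb0 : 0 ≤ b) (hb : b ≤ Real.pi)
    (hg : IntervalIntegrable g volume 0 b)
    (h : ∀ θ ∈ Set.Ioo 0 b, g θ ≤ angularIntegrand 2 0 l θ) :
    ∫ θ in (0 : ℝ)..b, g θ ≤ angularIntegral 2 0 l := by
  have hsub : Set.Ioo 0 b ⊆ Set.Ioo (-Real.pi) Real.pi :=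
    Set.Ioo_subset_Ioo (by linarith [Real.pi_pos]) hb
  rw [intervalIntegral.integral_of_le hb0, integral_Ioc_eq_integral_Ioo]
  calc ∫ θ in Set.Ioo 0 b, g θ ≤ ∫ θ in Set.Ioo 0 b, angularIntegrand 2 0 l θ :=
        setIntegral_mono_on (hg.1.mono_set Set.Ioo_subset_Ioc_self)
          ((integrableOn_angularIntegrand 2 0 hl).mono_set hsub) measurableSet_Ioo h
    _ ≤ _ := setIntegral_mono_set (integrableOn_angularIntegrand 2 0 hl)
        (Eventually.of_forall fun θ => angularIntegrand_nonneg 2 0 (by decide) (by decide) l θ)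
        hsub.eventuallyLE

lemma sqrt_cube_le_of_le_two_mul_sq {d c : ℝ} (hc : 0 ≤ c) (h : d ≤ 2 * c ^ 2) :
    √d ^ 3 ≤ 4 * c ^ 3 := by
  have h1 : √d ≤ √2 * c := by
    rw [Real.sqrt_le_left (by positivity), mul_pow, Real.sq_sqrt (by norm_num)]
    exact h
  have h2 : √2 ^ 3 ≤ 4 := by
    have : √2 ≤ 2 := by rw [Real.sqrt_le_left] <;> norm_num
    nlinarith [Real.sq_sqrt (show (0 : ℝ) ≤ 2 by norm_num)]
  calc √d ^ 3 ≤ (√2 * c) ^ 3 := by gcongr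
    _ = √2 ^ 3 * c ^ 3 := mul_pow _ _ _
    _ ≤ 4 * c ^ 3 := by gcongr

/-- On the arc `0 < θ < 1 / l` both `cos θ ≥ 1/2` and `l sin θ ≤ 1` hold, so the integrand is at
least `(1/4) / 4`. -/
lemma angularIntegral_20_ge_of_one_le {l : ℝ} (hl : 1 ≤ l) :
    1 / (16 * l) ≤ angularIntegral 2 0 l := by
  have hl0 : 0 < l := by linarith
  have hl1 : 1 / l ≤ 1 := by rw [div_le_one hl0]; exact hl
  have h := le_angularIntegral_20 (b := 1 / l) (g := fun _ => 1 / 16) hl0 (by positivity)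
    (by linarith [Real.pi_gt_three]) (by simp) fun θ hθ => ?_
  · refine le_trans (le_of_eq ?_) h
    simp
  · have hc : 1 / 2 ≤ Real.cos θ := by
      have := Real.one_sub_sq_div_two_le_cos (x := θ)
      nlinarith [hθ.1, hθ.2]
    have hs : l * Real.sin θ ≤ 1 := by
      have h1 := Real.sin_le hθ.1.le
      have h2 : l * θ ≤ 1 := by
        have := hθ.2.le
        rw [le_div_iff₀ hl0] at this
        linarith
      nlinarith
    have hs0 : 0 ≤ Real.sin θ :=
      Real.sin_nonneg_of_nonneg_of_le_pi hθ.1.le (by linarith [Real.pi_gt_three, hθ.2])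
    have hD : √(Real.cos θ ^ 2 + l ^ 2 * Real.sin θ ^ 2) ^ 3 ≤ 4 * 1 ^ 3 := by
      apply sqrt_cube_le_of_le_two_mul_sq zero_le_one
      have : (l * Real.sin θ) ^ 2 ≤ 1 := pow_le_one₀ (by positivity) hs
      nlinarith [Real.cos_sq_le_one θ]
    have hD0 := Real.sqrt_pos.2 (cos_sq_add_mul_sin_sq_pos hl0 θ)
    rw [angularIntegrand, le_div_iff₀ (by positivity)]
    nlinarith

/-- As long as `cos θ ≥ l`, the integrand is at least `1 / (4 cos θ)`, which is at least `1 / (4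
(π/2 - θ))`; the latter has a logarithmic integral up to the cutoff. -/
lemma angularIntegral_20_ge_of_le_one {l : ℝ} (hl : 0 < l) (hl1 : l ≤ 1) :
    Real.log (1 / l) / 4 ≤ angularIntegral 2 0 l := by
  have hpi := Real.pi_pos
  -- By Jordan's inequality `2 x / π ≤ sin x`, this cutoff guarantees `cos θ ≥ l` on `(0, b)`.
  set b := Real.pi / 2 - Real.pi / 2 * l with hb
  have hb0 : 0 ≤ b := by rw [hb]; nlinarith
  have hpl : 0 < Real.pi / 2 * l := by positivity
  have h := le_angularIntegral_20 (b := b) (g := fun θ => (Real.pi / 2 - θ)⁻¹ * (1 / 4)) hl hb0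
    (by linarith) ?_ fun θ hθ => ?_
  · refine le_trans (le_of_eq ?_) h
    rw [intervalIntegral.integral_mul_const,
      intervalIntegral.integral_comp_sub_left (fun x => x⁻¹) (Real.pi / 2), hb, sub_sub_cancel,
      sub_zero, integral_inv_of_pos hpl (by positivity)]
    rw [show Real.pi / 2 / (Real.pi / 2 * l) = 1 / l by field_simp]
    ring
  · refine ContinuousOn.intervalIntegrable ?_
    refine ContinuousOn.mul (ContinuousOn.inv₀ (by fun_prop) fun θ hθ => ?_) (by fun_prop)
    rw [Set.uIcc_of_le hb0] at hθ
    linarith [hθ.2]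
  · have hx0 : 0 < Real.pi / 2 - θ := by linarith [hθ.2]
    have hc : l ≤ Real.cos θ := by
      rw [← Real.sin_pi_div_two_sub]
      refine le_trans ?_ (Real.mul_le_sin hx0.le (by linarith [hθ.1]))
      rw [← mul_le_mul_iff_right₀ (by positivity : 0 < Real.pi / 2)]
      have : Real.pi / 2 * (2 / Real.pi * (Real.pi / 2 - θ)) = Real.pi / 2 - θ := by field_simp
      rw [this]
      linarith [hθ.2]
    have hc' : Real.cos θ ≤ Real.pi / 2 - θ := by
      rw [← Real.sin_pi_div_two_sub]
      exact Real.sin_le hx0.le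
    have hc0 : 0 < Real.cos θ := hl.trans_le hc
    have hD : √(Real.cos θ ^ 2 + l ^ 2 * Real.sin θ ^ 2) ^ 3 ≤ 4 * Real.cos θ ^ 3 := by
      apply sqrt_cube_le_of_le_two_mul_sq hc0.le
      nlinarith [Real.sin_sq_le_one θ, sq_nonneg (Real.sin θ)]
    have hD0 := Real.sqrt_pos.2 (cos_sq_add_mul_sin_sq_pos hl θ)
    calc (Real.pi / 2 - θ)⁻¹ * (1 / 4) ≤ (Real.cos θ)⁻¹ * (1 / 4) := by gcongr
      _ = Real.cos θ ^ 2 / (4 * Real.cos θ ^ 3) := by field_simp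
      _ ≤ Real.cos θ ^ 2 / √(Real.cos θ ^ 2 + l ^ 2 * Real.sin θ ^ 2) ^ 3 := by gcongr
      _ = _ := by simp [angularIntegrand]

lemma angularIntegral_22_le {l : ℝ} (hl : 1 ≤ l) :
    angularIntegral 2 2 l ≤ 2 * Real.pi * (1 / l ^ 2) := by
  have hl0 : 0 < l := by linarith
  refine angularIntegral_le 2 2 hl0 fun θ => ?_
  have hD1 : 1 ≤ √(Real.cos θ ^ 2 + l ^ 2 * Real.sin θ ^ 2) := by
    rw [Real.one_le_sqrt]
    have : 0 ≤ (l ^ 2 - 1) * Real.sin θ ^ 2 := mul_nonneg (by nlinarith) (sq_nonneg _)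
    linarith [Real.sin_sq_add_cos_sq θ]
  have hsq := Real.sq_sqrt (cos_sq_add_mul_sin_sq_pos hl0 θ).le
  set d := √(Real.cos θ ^ 2 + l ^ 2 * Real.sin θ ^ 2) with hd
  rw [angularIntegrand, ← hd, div_le_div_iff₀ (by positivity) (by positivity)]
  calc Real.cos θ ^ 2 * Real.sin θ ^ 2 * l ^ 2 ≤ 1 * Real.sin θ ^ 2 * l ^ 2 := by
        gcongr; exact Real.cos_sq_le_one θ
    _ ≤ d ^ 2 := by rw [hsq]; nlinarith [sq_nonneg (Real.cos θ)]
    _ ≤ d ^ 3 := pow_le_pow_right₀ hD1 (by norm_num)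
    _ = 1 * d ^ 3 := (one_mul _).symm

lemma angularIntegral_40_le {l : ℝ} (hl : 0 < l) : angularIntegral 4 0 l ≤ 2 * Real.pi * 1 := by
  refine angularIntegral_le 4 0 hl fun θ => ?_
  have hD0 := Real.sqrt_pos.2 (cos_sq_add_mul_sin_sq_pos hl θ)
  have hc : |Real.cos θ| ≤ √(Real.cos θ ^ 2 + l ^ 2 * Real.sin θ ^ 2) := by
    apply Real.abs_le_sqrt
    have : 0 ≤ l ^ 2 * Real.sin θ ^ 2 := by positivity
    linarith
  rw [angularIntegrand, div_le_one (by positivity)]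
  calc Real.cos θ ^ 4 * Real.sin θ ^ 0 = |Real.cos θ| * |Real.cos θ| ^ 3 := by
        rw [← pow_succ', Even.pow_abs (by decide)]; simp
    _ ≤ 1 * √(Real.cos θ ^ 2 + l ^ 2 * Real.sin θ ^ 2) ^ 3 := by
        gcongr; exact Real.abs_cos_le_one θ
    _ = _ := one_mul _

lemma angularIntegral_nonneg (i j : ℕ) (hi : Even i) (hj : Even j) (l : ℝ) :
    0 ≤ angularIntegral i j l :=
  integral_nonneg fun θ => angularIntegrand_nonneg i j hi hj l θ

lemma angularIntegral_20_pos {l : ℝ} (hl : 0 < l) : 0 < angularIntegral 2 0 l := by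
  have hpi := Real.pi_pos
  refine lt_of_lt_of_le (?_ : 0 < ∫ _ in (0 : ℝ)..(1 / (1 + l)), 1 / (32 * (1 + l) ^ 3)) ?_
  · rw [intervalIntegral.integral_const, smul_eq_mul, sub_zero]
    positivity
  have hb : 1 / (1 + l) ≤ 1 := by rw [div_le_one (by positivity)]; linarith
  refine le_angularIntegral_20 hl (by positivity) (by linarith [Real.pi_gt_three]) (by simp)
    fun θ hθ => ?_
  have hc : 1 / 2 ≤ Real.cos θ := by
    have := Real.one_sub_sq_div_two_le_cos (x := θ)
    nlinarith [hθ.1, hθ.2]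
  have hD0 := Real.sqrt_pos.2 (cos_sq_add_mul_sin_sq_pos hl θ)
  have hD : √(Real.cos θ ^ 2 + l ^ 2 * Real.sin θ ^ 2) ^ 3 ≤ 4 * (1 + l) ^ 3 := by
    apply sqrt_cube_le_of_le_two_mul_sq (by positivity)
    nlinarith [Real.cos_sq_le_one θ, Real.sin_sq_le_one θ, sq_nonneg l]
  rw [angularIntegrand, div_le_div_iff₀ (by positivity) (by positivity)]
  have h1 : (1 / 2) ^ 2 ≤ Real.cos θ ^ 2 := by gcongr
  nlinarith [pow_pos (by linarith : 0 < 1 + l) 3]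

lemma tendsto_angular_quotient_atTop :
    Tendsto (fun l => angularIntegral 2 2 l / angularIntegral 2 0 l) atTop (𝓝 0) := by
  have h0 : Tendsto (fun l : ℝ => 32 * Real.pi / l) atTop (𝓝 0) :=
    tendsto_const_nhds.div_atTop tendsto_id
  refine tendsto_of_tendsto_of_tendsto_of_le_of_le' tendsto_const_nhds h0 ?_ ?_
  · filter_upwards with l
    exact div_nonneg (angularIntegral_nonneg 2 2 (by decide) (by decide) l)
      (angularIntegral_nonneg 2 0 (by decide) (by decide) l)
  · filter_upwards [eventually_ge_atTop 1] with l hl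
    have hl0 : 0 < l := by linarith
    calc angularIntegral 2 2 l / angularIntegral 2 0 l
        ≤ 2 * Real.pi * (1 / l ^ 2) / (1 / (16 * l)) :=
          div_le_div₀ (by positivity) (angularIntegral_22_le hl) (by positivity)
            (angularIntegral_20_ge_of_one_le hl)
      _ = 32 * Real.pi / l := by field_simp; norm_num

/-- The quotient is one minus that of the `(4, 0)` and `(2, 0)` integrals; there the numerator stays
bounded while the denominator diverges logarithmically. -/
lemma tendsto_angular_quotient_zero :
    Tendsto (fun l => angularIntegral 2 2 l / angularIntegral 2 0 l) (𝓝[>] 0) (𝓝 1) := by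
  have h20 : Tendsto (angularIntegral 2 0) (𝓝[>] 0) atTop := by
    have hlog : Tendsto (fun l : ℝ => Real.log (1 / l) / 4) (𝓝[>] 0) atTop := by
      simp only [one_div]
      exact (Real.tendsto_log_atTop.comp tendsto_inv_nhdsGT_zero).atTop_div_const (by norm_num)
    refine tendsto_atTop_mono' _ ?_ hlog
    filter_upwards [Ioc_mem_nhdsGT one_pos] with l hl
    exact angularIntegral_20_ge_of_le_one hl.1 hl.2
  have h40 : Tendsto (fun l => angularIntegral 4 0 l / angularIntegral 2 0 l) (𝓝[>] 0) (𝓝 0) := by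
    have h0 : Tendsto (fun l => 2 * Real.pi * 1 / angularIntegral 2 0 l) (𝓝[>] 0) (𝓝 0) :=
      tendsto_const_nhds.div_atTop h20
    refine tendsto_of_tendsto_of_tendsto_of_le_of_le' tendsto_const_nhds h0 ?_ ?_
    · filter_upwards with l
      exact div_nonneg (angularIntegral_nonneg 4 0 (by decide) (by decide) l)
        (angularIntegral_nonneg 2 0 (by decide) (by decide) l)
    · filter_upwards [self_mem_nhdsWithin] with l hl
      have := angularIntegral_20_pos hl
      gcongr
      exact angularIntegral_40_le hl
  have h1 := h40.const_sub 1
  rw [sub_zero] at h1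
  refine h1.congr' ?_
  filter_upwards [self_mem_nhdsWithin] with l hl
  have := angularIntegral_20_pos hl
  rw [← angularIntegral_22_add_40 hl] at this ⊢
  field_simp
  ring

/-! ### Inversion of the parameter and the limits of `Q₁` and `Q₂` -/

/-- The reflection of the plane interchanging the coordinates. -/
noncomputable def planeSwap : Plane ≃ₗᵢ[ℝ] Plane :=
  LinearIsometryEquiv.piLpCongrLeft 2 ℝ ℝ (Equiv.swap 0 1)

lemma planeSwap_apply (p : Plane) : planeSwap p 0 = p 1 ∧ planeSwap p 1 = p 0 := by
  simp [planeSwap, LinearIsometryEquiv.piLpCongrLeft_apply, Equiv.piCongrLeft']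

lemma setIntegral_closedBall_comp_isometry (e : Plane ≃ₗᵢ[ℝ] Plane) (f : Plane → ℝ) (r : ℝ) :
    ∫ p in Metric.closedBall (0 : Plane) r, f (e p) = ∫ p in Metric.closedBall (0 : Plane) r, f p := by
  rw [← e.measurePreserving.setIntegral_preimage_emb e.toHomeomorph.measurableEmbedding f,
    e.preimage_closedBall, map_zero]

lemma ellipticIntegral_swap (i j : ℕ) {l : ℝ} (hl : 0 < l) :
    ellipticIntegral i j l = (l ^ 3)⁻¹ * ellipticIntegral j i l⁻¹ := by
  rw [ellipticIntegral, ← setIntegral_closedBall_comp_isometry planeSwap, ellipticIntegral,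
    ← integral_const_mul]
  congr 1
  ext p
  obtain ⟨h0, h1⟩ := planeSwap_apply p
  rw [ellipticIntegrand, ellipticIntegrand, h0, h1, rpow_three_halves (by positivity),
    rpow_three_halves (by positivity)]
  have : √(p 1 ^ 2 + l ^ 2 * p 0 ^ 2) = l * √(p 0 ^ 2 + l⁻¹ ^ 2 * p 1 ^ 2) := by
    rw [← Real.sqrt_sq hl.le, ← Real.sqrt_mul (sq_nonneg l), Real.sqrt_sq hl.le]
    congr 1
    field_simp
    ring
  rw [this, mul_pow, mul_comm (p 1 ^ i), div_mul_eq_div_div_swap]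
  field_simp

lemma ellipticIntegral_20_pos {l : ℝ} (hl : 0 < l) : 0 < ellipticIntegral 2 0 l := by
  rw [ellipticIntegral_eq_angularIntegral 2 0 le_rfl]
  simpa using angularIntegral_20_pos hl

lemma ellipticIntegral_02_pos {l : ℝ} (hl : 0 < l) : 0 < ellipticIntegral 0 2 l := by
  rw [ellipticIntegral_swap _ _ hl]
  have := ellipticIntegral_20_pos (inv_pos.2 hl)
  positivity

lemma coeffQ₁_eq {l : ℝ≥0∞} (h0 : l ≠ 0) (h1 : l ≠ ∞) :
    coeffQ₁ l = angularIntegral 2 2 l.toReal / angularIntegral 2 0 l.toReal := by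
  rw [coeffQ₁, if_neg h0, if_neg h1, ellipticIntegral_eq_angularIntegral 2 0 le_rfl,
    ellipticIntegral_eq_angularIntegral 2 2 (by norm_num)]
  norm_num
  congr 1
  ring

/-- Swapping coordinates turns `Q₂(l)` into the quotient of the angular integrals `(4, 0)` and `(2,
0)` at `l⁻¹`, and `cos⁴ + cos² sin² = cos²` gives the rest. The limits of `Q₂` thus follow from
those of `Q₁` at the opposite end. -/
lemma coeffQ₂_eq {l : ℝ≥0∞} (h0 : l ≠ 0) (h1 : l ≠ ∞) : coeffQ₂ l = 1 - coeffQ₁ l⁻¹ := by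
  have hl := ENNReal.toReal_pos h0 h1
  have hl' := inv_pos.2 hl
  rw [coeffQ₁_eq (by simpa using h1) (by simpa using h0), ENNReal.toReal_inv, coeffQ₂, if_neg h0,
    if_neg h1, ellipticIntegral_swap 0 4 hl, ellipticIntegral_swap 0 2 hl,
    ellipticIntegral_eq_angularIntegral 4 0 (by norm_num),
    ellipticIntegral_eq_angularIntegral 2 0 le_rfl, ← angularIntegral_22_add_40 hl']
  have := angularIntegral_20_pos hl'
  rw [← angularIntegral_22_add_40 hl'] at this
  generalize angularIntegral 2 2 l.toReal⁻¹ = a at this ⊢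
  generalize angularIntegral 4 0 l.toReal⁻¹ = b at this ⊢
  norm_num
  field_simp
  ring

lemma tendsto_coeffQ₁_zero : Tendsto coeffQ₁ (𝓝[≠] 0) (𝓝 1) := by
  have h : Tendsto ENNReal.toReal (𝓝[≠] 0) (𝓝[>] 0) := by
    refine tendsto_nhdsWithin_iff.2 ⟨?_, ?_⟩
    · exact (ENNReal.tendsto_toReal ENNReal.zero_ne_top).mono_left nhdsWithin_le_nhds
    · filter_upwards [self_mem_nhdsWithin,
        nhdsWithin_le_nhds (isOpen_ne.mem_nhds ENNReal.zero_ne_top)] with l h0 h1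
      exact ENNReal.toReal_pos h0 h1
  refine (tendsto_angular_quotient_zero.comp h).congr' ?_
  filter_upwards [self_mem_nhdsWithin,
    nhdsWithin_le_nhds (isOpen_ne.mem_nhds ENNReal.zero_ne_top)] with l h0 h1
  exact (coeffQ₁_eq h0 h1).symm

lemma tendsto_coeffQ₁_top : Tendsto coeffQ₁ (𝓝[≠] ∞) (𝓝 0) := by
  have h : Tendsto ENNReal.toReal (𝓝[≠] ∞) atTop := by
    refine tendsto_atTop.2 fun b => ?_
    filter_upwards [self_mem_nhdsWithin, nhdsWithin_le_nhds
      (lt_mem_nhds (ENNReal.ofReal_lt_top (r := b)))] with l h0 h1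
    exact (ENNReal.ofReal_le_iff_le_toReal h0).1 h1.le
  refine (tendsto_angular_quotient_atTop.comp h).congr' ?_
  filter_upwards [self_mem_nhdsWithin,
    nhdsWithin_le_nhds (isOpen_ne.mem_nhds ENNReal.top_ne_zero)] with l h0 h1
  exact (coeffQ₁_eq h1 h0).symm

lemma tendsto_ennreal_inv_nhdsNE (a : ℝ≥0∞) :
    Tendsto (fun l : ℝ≥0∞ => l⁻¹) (𝓝[≠] a) (𝓝[≠] a⁻¹) := by
  refine tendsto_nhdsWithin_iff.2 ⟨(continuous_inv.tendsto a).mono_left nhdsWithin_le_nhds, ?_⟩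
  filter_upwards [self_mem_nhdsWithin] with l hl
  simpa using hl

lemma tendsto_coeffQ₂_zero : Tendsto coeffQ₂ (𝓝[≠] 0) (𝓝 1) := by
  have h := tendsto_ennreal_inv_nhdsNE 0
  rw [ENNReal.inv_zero] at h
  have h1 := (tendsto_coeffQ₁_top.comp h).const_sub 1
  rw [sub_zero] at h1
  refine h1.congr' ?_
  filter_upwards [self_mem_nhdsWithin,
    nhdsWithin_le_nhds (isOpen_ne.mem_nhds ENNReal.zero_ne_top)] with l h0 h1
  exact (coeffQ₂_eq h0 h1).symm

lemma tendsto_coeffQ₂_top : Tendsto coeffQ₂ (𝓝[≠] ∞) (𝓝 0) := by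
  have h := tendsto_ennreal_inv_nhdsNE ∞
  rw [ENNReal.inv_top] at h
  have h1 := (tendsto_coeffQ₁_zero.comp h).const_sub 1
  rw [sub_self] at h1
  refine h1.congr' ?_
  filter_upwards [self_mem_nhdsWithin,
    nhdsWithin_le_nhds (isOpen_ne.mem_nhds ENNReal.top_ne_zero)] with l h0 h1
  exact (coeffQ₂_eq h1 h0).symm

/-! ### Second order expansions -/

/-- The remainder, as a function of the increment `w`, has derivative `fderiv ℝ u (x + w) - A - B
w`, which is `o(‖w‖)` because `fderiv ℝ u` is differentiable at `x`. The mean value inequality on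
the ball of radius `‖z‖` concludes. -/
lemma ContDiffAt.eventually_norm_taylor_two_le {E F : Type*} [NormedAddCommGroup E]
    [NormedSpace ℝ E] [NormedAddCommGroup F] [NormedSpace ℝ F] {u : E → F} {x : E}
    (hu : ContDiffAt ℝ 2 u x) {ε : ℝ} (hε : 0 < ε) :
    ∃ δ > 0, ∀ z : E, ‖z‖ ≤ δ →
      ‖u (x + z) - u x - fderiv ℝ u x z - (1 / 2 : ℝ) • fderiv ℝ (fderiv ℝ u) x z z‖
        ≤ ε * ‖z‖ ^ 2 := by
  have hsymm : IsSymmSndFDerivAt ℝ u x := hu.isSymmSndFDerivAt (by simp)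
  have hd : ∀ᶠ y in 𝓝 x, DifferentiableAt ℝ u y :=
    (hu.eventually (by simp)).mono fun y hy => hy.differentiableAt (by norm_num)
  have hd2 : DifferentiableAt ℝ (fderiv ℝ u) x :=
    (hu.fderiv_right (m := 1) (by norm_num)).differentiableAt (by norm_num)
  have hlo := hd2.hasFDerivAt.isLittleO.def hε
  obtain ⟨δ, hδ, hball⟩ := Metric.eventually_nhds_iff_ball.1 (hd.and hlo)
  refine ⟨δ / 2, by positivity, fun z hz => ?_⟩
  set A := fderiv ℝ u x with hA
  set B := fderiv ℝ (fderiv ℝ u) x with hB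
  have hmem : ∀ w ∈ Metric.closedBall (0 : E) ‖z‖, x + w ∈ Metric.ball x δ := fun w hw => by
    rw [mem_closedBall_zero_iff] at hw
    rw [mem_ball_iff_norm, add_sub_cancel_left]
    linarith
  have hder : ∀ w ∈ Metric.closedBall (0 : E) ‖z‖,
      HasFDerivWithinAt (fun w => u (x + w) - u x - A w - (1 / 2 : ℝ) • B w w)
        (fderiv ℝ u (x + w) - A - B w) (Metric.closedBall 0 ‖z‖) w := by
    intro w hw
    have h1 : HasFDerivAt (fun w => u (x + w)) (fderiv ℝ u (x + w)) w := by
      simpa [Function.comp_def] using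
        (hball _ (hmem w hw)).1.hasFDerivAt.comp w ((hasFDerivAt_id w).const_add x)
    have h2 : HasFDerivAt (fun w => B w w) (B w + B.flip w) w := by
      simpa using B.hasFDerivAt.clm_apply (hasFDerivAt_id w)
    have h3 := ((h1.sub_const (u x)).sub A.hasFDerivAt).sub (h2.const_smul (1 / 2 : ℝ))
    -- Symmetry of the second derivative makes the quadratic term differentiate to `B w`.
    have heq : (1 / 2 : ℝ) • (B w + B.flip w) = B w := by
      have : B.flip w = B w := ContinuousLinearMap.ext fun v => hsymm v w
      rw [this, ← two_smul ℝ (B w), smul_smul]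
      norm_num
    rw [heq] at h3
    exact h3.hasFDerivWithinAt
  have hbound : ∀ w ∈ Metric.closedBall (0 : E) ‖z‖,
      ‖fderiv ℝ u (x + w) - A - B w‖ ≤ ε * ‖z‖ := by
    intro w hw
    have := (hball _ (hmem w hw)).2
    rw [add_sub_cancel_left] at this
    refine this.trans ?_
    gcongr
    simpa using hw
  have := (convex_closedBall (0 : E) ‖z‖).norm_image_sub_le_of_norm_hasFDerivWithin_le hder hbound
    (Metric.mem_closedBall_self (norm_nonneg z)) (by simp : z ∈ Metric.closedBall (0 : E) ‖z‖)
  simpa [pow_two, mul_assoc] using this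

section NormRemainder

variable {E : Type*} [NormedAddCommGroup E] [InnerProductSpace ℝ E]

/-- The remainder of the first order Taylor expansion of the norm at `v` in direction `w`. -/
noncomputable def normRemainder (v w : E) : ℝ := ‖v + w‖ - ‖v‖ - inner ℝ v w / ‖v‖

lemma norm_add_sq_eq_of_ne_zero {v : E} (hv : v ≠ 0) (w : E) :
    ‖v + w‖ ^ 2 = (‖v‖ + inner ℝ v w / ‖v‖) ^ 2 + (‖w‖ ^ 2 - (inner ℝ v w / ‖v‖) ^ 2) := by
  have : ‖v‖ ≠ 0 := norm_ne_zero_iff.2 hv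
  rw [norm_add_sq_real]
  field_simp
  ring

lemma abs_inner_div_norm_le (v w : E) : |inner ℝ v w / ‖v‖| ≤ ‖w‖ := by
  rcases eq_or_ne v 0 with rfl | hv
  · simp
  rw [abs_div, abs_norm, div_le_iff₀ (norm_pos_iff.2 hv), mul_comm]
  exact abs_real_inner_le_norm v w

/-- The norm of `v + w` is at least its component along `v`. -/
lemma normRemainder_nonneg (v w : E) : 0 ≤ normRemainder v w := by
  rcases eq_or_ne v 0 with rfl | hv
  · simp [normRemainder]
  have h1 := norm_add_sq_eq_of_ne_zero hv w
  have h2 : (inner ℝ v w / ‖v‖) ^ 2 ≤ ‖w‖ ^ 2 :=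
    sq_le_sq' (neg_le_of_abs_le (abs_inner_div_norm_le v w)) (le_of_abs_le (abs_inner_div_norm_le v w))
  have h3 : ‖v‖ + inner ℝ v w / ‖v‖ ≤ ‖v + w‖ :=
    (le_abs_self _).trans (abs_le_of_sq_le_sq (by linarith) (norm_nonneg _))
  rw [normRemainder]
  linarith

/-- Expand `0 ≤ (‖v + w‖ - ‖v‖)²`. This bound supplies the dominating function for the passage to
the limit. -/
lemma normRemainder_le {v : E} (hv : v ≠ 0) (w : E) :
    normRemainder v w ≤ ‖w‖ ^ 2 / (2 * ‖v‖) := by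
  have hv0 : 0 < ‖v‖ := norm_pos_iff.2 hv
  have h1 := norm_add_sq_real v w
  have h2 : inner ℝ v w / ‖v‖ * ‖v‖ = inner ℝ v w := div_mul_cancel₀ _ hv0.ne'
  rw [le_div_iff₀ (by positivity), normRemainder]
  nlinarith [sq_nonneg (‖v + w‖ - ‖v‖)]

/-- Rationalised form of the difference: the numerator is purely quadratic in `w` and the
denominator tends to `2 ‖v‖`, which exhibits the second order coefficient. -/
lemma normRemainder_eq {v w : E} (hv : v ≠ 0) (h : ‖v + w‖ + ‖v‖ + inner ℝ v w / ‖v‖ ≠ 0) :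
    normRemainder v w =
      (‖w‖ ^ 2 - (inner ℝ v w / ‖v‖) ^ 2) / (‖v + w‖ + ‖v‖ + inner ℝ v w / ‖v‖) := by
  rw [eq_div_iff h, normRemainder]
  linear_combination norm_add_sq_eq_of_ne_zero hv w

lemma tendsto_normRemainder {ι : Type*} {l : Filter ι} {v : E} (hv : v ≠ 0) {r : ι → ℝ}
    (hr : Tendsto r l (𝓝 0)) (hr0 : ∀ᶠ i in l, r i ≠ 0) {a : ι → E} {b : E}
    (ha : Tendsto a l (𝓝 b)) :
    Tendsto (fun i => (r i ^ 2)⁻¹ * normRemainder v (r i • a i)) l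
      (𝓝 ((‖v‖ ^ 2 * ‖b‖ ^ 2 - inner ℝ v b ^ 2) / (2 * ‖v‖ ^ 3))) := by
  have hv0 : 0 < ‖v‖ := norm_pos_iff.2 hv
  have hw : Tendsto (fun i => r i • a i) l (𝓝 0) := by simpa using hr.smul ha
  have hden : Tendsto (fun i => ‖v + r i • a i‖ + ‖v‖ + inner ℝ v (r i • a i) / ‖v‖) l
      (𝓝 (2 * ‖v‖)) := by
    have h1 : Tendsto (fun i => ‖v + r i • a i‖) l (𝓝 ‖v‖) := by
      simpa using (tendsto_const_nhds.add hw : Tendsto (fun i => v + r i • a i) l (𝓝 (v + 0))).norm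
    have h2 : Tendsto (fun i => inner ℝ v (r i • a i) / ‖v‖) l (𝓝 0) := by
      simpa using ((tendsto_const_nhds (x := v)).inner hw).div_const ‖v‖
    have := (h1.add_const ‖v‖).add h2
    rwa [add_zero, ← two_mul] at this
  have hnum : Tendsto (fun i => ‖a i‖ ^ 2 - (inner ℝ v (a i) / ‖v‖) ^ 2) l
      (𝓝 (‖b‖ ^ 2 - (inner ℝ v b / ‖v‖) ^ 2)) :=
    (ha.norm.pow 2).sub ((((tendsto_const_nhds (x := v)).inner ha).div_const ‖v‖).pow 2)
  have hlim := hnum.div hden (by positivity)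
  have heq : (‖b‖ ^ 2 - (inner ℝ v b / ‖v‖) ^ 2) / (2 * ‖v‖)
      = (‖v‖ ^ 2 * ‖b‖ ^ 2 - inner ℝ v b ^ 2) / (2 * ‖v‖ ^ 3) := by
    field_simp
  rw [heq] at hlim
  refine hlim.congr' ?_
  filter_upwards [hr0, hden.eventually_ne (by positivity)] with i hi hd
  rw [Pi.div_apply, normRemainder_eq hv hd, norm_smul, inner_smul_right, ← mul_div_assoc]
  congr 1
  rw [mul_pow, Real.norm_eq_abs, sq_abs]
  field_simp

lemma abs_inv_sq_mul_normRemainder_le {v : E} (hv : v ≠ 0) {r : ℝ} (hr : r ≠ 0) (a : E) :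
    |(r ^ 2)⁻¹ * normRemainder v (r • a)| ≤ ‖a‖ ^ 2 / 2 * ‖v‖⁻¹ := by
  have hv0 : 0 < ‖v‖ := norm_pos_iff.2 hv
  rw [abs_of_nonneg (mul_nonneg (by positivity) (normRemainder_nonneg _ _))]
  calc (r ^ 2)⁻¹ * normRemainder v (r • a) ≤ (r ^ 2)⁻¹ * (‖r • a‖ ^ 2 / (2 * ‖v‖)) := by
        gcongr; exact normRemainder_le hv _
    _ = ‖a‖ ^ 2 / 2 * ‖v‖⁻¹ := by
        rw [norm_smul, mul_pow, Real.norm_eq_abs, sq_abs]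
        field_simp

end NormRemainder

/-! ### Convergence of minimisers of convex functions -/

/-- By compactness of the sphere of radius `ε` around `c₀`, joint convergence eventually gives `F r
c₀ < F r p` for all its points `p`. If `c r` lay on or outside the sphere, the segment from `c₀` to
`c r` would meet the sphere at a point where convexity gives a value at most `F r c₀`. -/
lemma tendsto_minimizer_of_convexOn {E : Type*} [NormedAddCommGroup E] [NormedSpace ℝ E]
    [ProperSpace E] {ι : Type*} {l : Filter ι} {F : ι → E → ℝ} {G : E → ℝ} {c₀ : E}
    (hconv : ∀ᶠ r in l, ConvexOn ℝ Set.univ (F r))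
    (hlim : ∀ c, Tendsto (fun q : ι × E => F q.1 q.2) (l ×ˢ 𝓝 c) (𝓝 (G c)))
    (hG : ∀ c, c ≠ c₀ → G c₀ < G c) {c : ι → E} (hc : ∀ᶠ r in l, F r (c r) ≤ F r c₀) :
    Tendsto c l (𝓝 c₀) := by
  have hlim₀ : Tendsto (fun r => F r c₀) l (𝓝 (G c₀)) :=
    (hlim c₀).comp (tendsto_id.prodMk tendsto_const_nhds)
  rw [Metric.tendsto_nhds]
  intro ε hε
  have hS : {q : ι × E | F q.1 c₀ < F q.1 q.2} ∈ l ×ˢ 𝓝ˢ (Metric.sphere c₀ ε) := by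
    refine (isCompact_sphere c₀ ε).mem_prod_nhdsSet_of_forall fun p hp => ?_
    have hne : p ≠ c₀ := by
      rintro rfl
      simp only [Metric.mem_sphere, dist_self] at hp
      exact hε.ne hp
    exact (hlim₀.comp tendsto_fst).eventually_lt (hlim p) (hG p hne)
  have hS' : ∀ᶠ r in l, ∀ p ∈ Metric.sphere c₀ ε, F r c₀ < F r p := by
    obtain ⟨s, hs, t, ht, hst⟩ := mem_prod_iff.1 hS
    filter_upwards [hs] with r hr p hp
    exact hst (Set.mk_mem_prod hr (subset_of_mem_nhdsSet ht hp))
  filter_upwards [hconv, hS', hc] with r hr hsph hmin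
  by_contra! hdist
  have hd : 0 < dist (c r) c₀ := hε.trans_le hdist
  set t := ε / dist (c r) c₀ with ht
  have ht0 : 0 ≤ t := by positivity
  have ht1 : t ≤ 1 := (div_le_one hd).2 hdist
  have hp : (1 - t) • c₀ + t • c r ∈ Metric.sphere c₀ ε := by
    rw [mem_sphere_iff_norm, show (1 - t) • c₀ + t • c r - c₀ = t • (c r - c₀) by module, norm_smul,
      Real.norm_of_nonneg ht0, ← dist_eq_norm, ht, div_mul_cancel₀ _ hd.ne']
  have h1 := hr.2 (Set.mem_univ c₀) (Set.mem_univ (c r)) (by linarith : 0 ≤ 1 - t) ht0 (by ring)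
  have h2 := hsph _ hp
  simp only [smul_eq_mul] at h1
  nlinarith

/-! ### The `L¹` median functional -/

/-- The functional whose minimisers are the `L¹` medians on a disc. -/
noncomputable def medianFunctional (u : Plane → Plane) (x : Plane) (ρ : ℝ) (m : Plane) : ℝ :=
  ∫ y in Metric.closedBall x ρ, ‖u y - m‖

section Existence

variable {u : Plane → Plane} {x : Plane} {ρ : ℝ}

lemma integrableOn_norm_sub (hu : ContinuousOn u (Metric.closedBall x ρ)) (m : Plane) :
    IntegrableOn (fun y => ‖u y - m‖) (Metric.closedBall x ρ) :=
  (hu.sub continuousOn_const).norm.integrableOn_compact (isCompact_closedBall x ρ)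

lemma convexOn_medianFunctional (hu : ContinuousOn u (Metric.closedBall x ρ)) :
    ConvexOn ℝ Set.univ (medianFunctional u x ρ) := by
  refine ⟨convex_univ, fun m _ n _ a b ha hb hab => ?_⟩
  simp only [medianFunctional, smul_eq_mul]
  rw [← integral_const_mul, ← integral_const_mul,
    ← integral_add ((integrableOn_norm_sub hu m).const_mul a)
      ((integrableOn_norm_sub hu n).const_mul b)]
  refine setIntegral_mono (integrableOn_norm_sub hu _) (((integrableOn_norm_sub hu m).const_mul
    a).add ((integrableOn_norm_sub hu n).const_mul b)) fun y => ?_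
  have : u y - (a • m + b • n) = a • (u y - m) + b • (u y - n) := by
    have : u y = (a + b) • u y := by rw [hab, one_smul]
    nth_rw 1 [this]
    module
  calc ‖u y - (a • m + b • n)‖ ≤ ‖a • (u y - m)‖ + ‖b • (u y - n)‖ := by
        rw [this]; exact norm_add_le _ _
    _ = a * ‖u y - m‖ + b * ‖u y - n‖ := by
        rw [norm_smul, norm_smul, Real.norm_of_nonneg ha, Real.norm_of_nonneg hb]

lemma exists_isL1MedianOnDisc (hρ : 0 < ρ) (hu : ContinuousOn u (Metric.closedBall x ρ)) :
    ∃ m, IsL1MedianOnDisc u x ρ m := by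
  have hcont : Continuous (medianFunctional u x ρ) := by
    rw [← continuousOn_univ]
    exact (convexOn_medianFunctional hu).continuousOn isOpen_univ
  set V := (volume : Measure Plane).real (Metric.closedBall x ρ) with hV
  have hV0 : 0 < V := by
    rw [hV, measureReal_def, ENNReal.toReal_pos_iff]
    exact ⟨Metric.measure_closedBall_pos _ _ hρ, measure_closedBall_lt_top⟩
  -- Integrating `‖m‖ ≤ ‖u y - m‖ + ‖u y‖` gives linear growth, hence coercivity.
  have hlow : ∀ m, V * ‖m‖ - medianFunctional u x ρ 0 ≤ medianFunctional u x ρ m := by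
    intro m
    rw [sub_le_iff_le_add, medianFunctional, medianFunctional,
      ← integral_add (integrableOn_norm_sub hu m) (integrableOn_norm_sub hu 0)]
    have : ∫ _ in Metric.closedBall x ρ, ‖m‖ = V * ‖m‖ := by
      rw [setIntegral_const, smul_eq_mul]
    rw [← this]
    refine setIntegral_mono (integrableOn_const measure_closedBall_lt_top.ne)
      ((integrableOn_norm_sub hu m).add (integrableOn_norm_sub hu 0)) fun y => ?_
    have := norm_sub_le (u y) (u y - m)
    simp only [sub_sub_cancel] at this
    simp only [sub_zero]
    linarith
  have hcoer : Tendsto (medianFunctional u x ρ) (cocompact Plane) atTop := by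
    refine tendsto_atTop_mono hlow ?_
    exact tendsto_atTop_add_const_right _ _
      ((tendsto_norm_cocompact_atTop (E := Plane)).const_mul_atTop hV0)
  exact hcont.exists_forall_le hcoer

lemma SameRay.cross_eq_zero {a b : Plane} (h : SameRay ℝ a b) : a 0 * b 1 - a 1 * b 0 = 0 := by
  rcases h with rfl | rfl | ⟨r, s, hr, hs, h⟩
  · simp
  · simp
  · have h0 : r * a 0 = s * b 0 := by simpa using congrArg (fun p : Plane => p 0) h
    have h1 : r * a 1 = s * b 1 := by simpa using congrArg (fun p : Plane => p 1) h
    have : r * (a 0 * b 1 - a 1 * b 0) = 0 := by linear_combination b 1 * h0 - b 0 * h1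
    exact (mul_eq_zero.1 this).resolve_left hr.ne'

/-- If there are two different medians, then all values lie on the line through them. -/
lemma IsL1MedianOnDisc.cross_eq_zero (hu : ContinuousOn u (Metric.closedBall x ρ)) {m n : Plane}
    (hm : IsL1MedianOnDisc u x ρ m) (hn : IsL1MedianOnDisc u x ρ n) :
    ∀ y ∈ Metric.ball x ρ, (u y 0 - m 0) * (n 1 - m 1) - (u y 1 - m 1) * (n 0 - m 0) = 0 := by
  set c : Plane := (1 / 2 : ℝ) • (m + n) with hc
  -- The convexity defect at the midpoint: nonnegative pointwise, but with integral at most zero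
  -- since `m` and `n` are both minimisers. It vanishes almost everywhere, on the open disc
  -- everywhere by continuity, and equality in the triangle inequality gives collinearity.
  set f : Plane → ℝ := fun y => ‖u y - m‖ + ‖u y - n‖ - 2 * ‖u y - c‖ with hf
  have h2c : ∀ y, (u y - m) + (u y - n) = (2 : ℝ) • (u y - c) := fun y => by rw [hc]; module
  have hnorm : ∀ y, ‖(u y - m) + (u y - n)‖ = 2 * ‖u y - c‖ := fun y => by
    rw [h2c, norm_smul]; norm_num
  have hf0 : ∀ y, 0 ≤ f y := fun y => by
    have := norm_add_le (u y - m) (u y - n)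
    rw [hnorm] at this
    simp only [hf]
    linarith
  have hfi : IntegrableOn f (Metric.closedBall x ρ) :=
    ((integrableOn_norm_sub hu m).add (integrableOn_norm_sub hu n)).sub
      ((integrableOn_norm_sub hu c).const_mul 2)
  have hint : ∫ y in Metric.closedBall x ρ, f y = 0 := by
    refine le_antisymm ?_ (integral_nonneg hf0)
    have : ∫ y in Metric.closedBall x ρ, f y
        = medianFunctional u x ρ m + medianFunctional u x ρ n - 2 * medianFunctional u x ρ c := by
      simp only [hf, medianFunctional]
      have hadd : IntegrableOn (fun y => ‖u y - m‖ + ‖u y - n‖) (Metric.closedBall x ρ) :=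
        (integrableOn_norm_sub hu m).add (integrableOn_norm_sub hu n)
      rw [integral_sub hadd ((integrableOn_norm_sub hu c).const_mul 2),
        integral_add (integrableOn_norm_sub hu m) (integrableOn_norm_sub hu n), integral_const_mul]
    rw [this]
    have h1 : medianFunctional u x ρ m ≤ medianFunctional u x ρ c := hm c
    have h2 : medianFunctional u x ρ n ≤ medianFunctional u x ρ c := hn c
    linarith
  have hae : f =ᵐ[volume.restrict (Metric.ball x ρ)] 0 :=
    ae_mono (Measure.restrict_mono Metric.ball_subset_closedBall le_rfl)
      ((integral_eq_zero_iff_of_nonneg hf0 hfi).1 hint)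
  have hub := hu.mono (Metric.ball_subset_closedBall (x := x) (ε := ρ))
  have hfc : ContinuousOn f (Metric.ball x ρ) := by
    simp only [hf]
    fun_prop
  have heq := Measure.eqOn_open_of_ae_eq hae Metric.isOpen_ball hfc continuousOn_const
  intro y hy
  have hy0 : ‖u y - m‖ + ‖u y - n‖ - 2 * ‖u y - c‖ = 0 := heq hy
  have hray : SameRay ℝ (u y - m) (u y - n) :=
    sameRay_iff_norm_add.2 (by rw [hnorm]; linarith)
  have := hray.cross_eq_zero
  simp only [PiLp.sub_apply] at this
  linear_combination -this

/-- The linear form `L` annihilating `n - m` is constant along `u` near `x`, so `L` composed with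
the derivative vanishes; surjectivity gives `L = 0`, that is, `m = n`. -/
lemma IsL1MedianOnDisc.unique (hρ : 0 < ρ) (hu : ContinuousOn u (Metric.closedBall x ρ))
    (hd : DifferentiableAt ℝ u x) (hsurj : Function.Surjective (fderiv ℝ u x)) {m n : Plane}
    (hm : IsL1MedianOnDisc u x ρ m) (hn : IsL1MedianOnDisc u x ρ n) : m = n := by
  have hzero := hm.cross_eq_zero hu hn
  set L : Plane →L[ℝ] ℝ := (n 1 - m 1) • EuclideanSpace.proj (0 : Fin 2)
    - (n 0 - m 0) • EuclideanSpace.proj (1 : Fin 2) with hL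
  have hLa : ∀ p : Plane, L p = (n 1 - m 1) * p 0 - (n 0 - m 0) * p 1 := fun p => by
    simp [hL]
  have hev : (fun y => L (u y)) =ᶠ[𝓝 x] fun _ => L m := by
    filter_upwards [Metric.ball_mem_nhds x hρ] with y hy
    rw [hLa, hLa]
    linear_combination hzero y hy
  have hcomp : HasFDerivAt (fun y => L (u y)) (L.comp (fderiv ℝ u x)) x :=
    L.hasFDerivAt.comp x hd.hasFDerivAt
  have h0 : L.comp (fderiv ℝ u x) = 0 :=
    hcomp.unique ((hasFDerivAt_const (L m) x).congr_of_eventuallyEq hev)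
  have hL0 : ∀ p, L p = 0 := fun p => by
    obtain ⟨z, rfl⟩ := hsurj p
    exact DFunLike.congr_fun h0 z
  have e0 := hL0 (EuclideanSpace.single 0 1)
  have e1 := hL0 (EuclideanSpace.single 1 1)
  rw [hLa] at e0 e1
  simp at e0 e1
  ext i
  fin_cases i
  · simp; linarith
  · simp; linarith

lemma existsUnique_isL1MedianOnDisc (hρ : 0 < ρ) (hu : ContinuousOn u (Metric.closedBall x ρ))
    (hd : DifferentiableAt ℝ u x) (hsurj : Function.Surjective (fderiv ℝ u x)) :
    ∃! m, IsL1MedianOnDisc u x ρ m := by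
  obtain ⟨m, hm⟩ := exists_isL1MedianOnDisc hρ hu
  exact ⟨m, hm, fun n hn => hn.unique hρ hu hd hsurj hm⟩

end Existence

/-! ### Rescaling of the median functional -/

lemma setIntegral_closedBall_eq_unit (f : Plane → ℝ) (x : Plane) {ρ : ℝ} (hρ : 0 < ρ) :
    ∫ y in Metric.closedBall x ρ, f y
      = ρ ^ 2 * ∫ z in Metric.closedBall (0 : Plane) 1, f (x + ρ • z) := by
  have h1 : ∫ y in Metric.closedBall x ρ, f y = ∫ z in Metric.closedBall (0 : Plane) ρ, f (x + z) := by
    rw [← (measurePreserving_add_left volume x).setIntegral_preimage_emb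
      (measurableEmbedding_addLeft x) f]
    congr 2
    ext z
    simp
  rw [h1, Measure.setIntegral_comp_smul_of_pos volume (fun z => f (x + z)) _ hρ,
    smul_unitClosedBall_of_nonneg hρ.le]
  simp
  field_simp

/-- The rescaled second order remainder of `u` at `x`. -/
noncomputable def secondOrderRemainder (u : Plane → Plane) (x : Plane) (ρ : ℝ) (z : Plane) : Plane :=
  (ρ ^ 2)⁻¹ • (u (x + ρ • z) - u x - ρ • fderiv ℝ u x z)

/-- The rescaled median functional, up to an additive constant. -/
noncomputable def scaledMedianFunctional (u : Plane → Plane) (x : Plane) (ρ : ℝ) (c : Plane) : ℝ :=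
  ∫ z in Metric.closedBall (0 : Plane) 1,
    (ρ ^ 2)⁻¹ * normRemainder (fderiv ℝ u x z) (ρ • (secondOrderRemainder u x ρ z - c))

/-- The limit of the rescaled median functionals. -/
noncomputable def limitMedianFunctional (A : Plane →L[ℝ] Plane) (h : Plane → Plane) (c : Plane) : ℝ :=
  ∫ z in Metric.closedBall (0 : Plane) 1,
    (‖A z‖ ^ 2 * ‖h z - c‖ ^ 2 - inner ℝ (A z) (h z - c) ^ 2) / (2 * ‖A z‖ ^ 3)

section Scaling

variable {u : Plane → Plane} {x : Plane} {ρ : ℝ}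

lemma continuousOn_secondOrderRemainder (hρ : 0 < ρ)
    (hu : ContinuousOn u (Metric.closedBall x ρ)) :
    ContinuousOn (secondOrderRemainder u x ρ) (Metric.closedBall 0 1) := by
  have hmaps : Set.MapsTo (fun z : Plane => x + ρ • z) (Metric.closedBall 0 1)
      (Metric.closedBall x ρ) := fun z hz => by
    rw [mem_closedBall_zero_iff] at hz
    rw [mem_closedBall_iff_norm, add_sub_cancel_left, norm_smul, Real.norm_of_nonneg hρ.le]
    nlinarith
  have h1 : ContinuousOn (fun z : Plane => u (x + ρ • z)) (Metric.closedBall 0 1) :=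
    hu.comp (by fun_prop) hmaps
  unfold secondOrderRemainder
  fun_prop

lemma integrableOn_inner_div_norm (A : Plane →L[ℝ] Plane) {w : Plane → Plane}
    (hw : ContinuousOn w (Metric.closedBall 0 1)) :
    IntegrableOn (fun z => inner ℝ (A z) (w z) / ‖A z‖) (Metric.closedBall 0 1) := by
  have hb : IntegrableOn (fun z => ‖w z‖) (Metric.closedBall 0 1) :=
    hw.norm.integrableOn_compact (isCompact_closedBall 0 1)
  have hm : AEMeasurable (fun z => inner ℝ (A z) (w z)) (volume.restrict (Metric.closedBall 0 1)) :=
    ((ContinuousOn.inner (𝕜 := ℝ) A.continuous.continuousOn hw).aestronglyMeasurable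
      Metric.isClosed_closedBall.measurableSet).aemeasurable
  have hm' : Measurable fun z => ‖A z‖ := by fun_prop
  exact hb.mono' (hm.div hm'.aemeasurable).aestronglyMeasurable
    (Eventually.of_forall fun z => abs_inner_div_norm_le _ _)

lemma integrableOn_normRemainder (A : Plane →L[ℝ] Plane) {w : Plane → Plane}
    (hw : ContinuousOn w (Metric.closedBall 0 1)) :
    IntegrableOn (fun z => normRemainder (A z) (w z)) (Metric.closedBall 0 1) := by
  have h1 : IntegrableOn (fun z => ‖A z + w z‖) (Metric.closedBall 0 1) :=
    (A.continuous.continuousOn.add hw).norm.integrableOn_compact (isCompact_closedBall 0 1)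
  have h2 : IntegrableOn (fun z => ‖A z‖) (Metric.closedBall 0 1) :=
    A.continuous.continuousOn.norm.integrableOn_compact (isCompact_closedBall 0 1)
  exact (h1.sub h2).sub (integrableOn_inner_div_norm A hw)

lemma integral_inner_div_norm_eq_zero (A : Plane →L[ℝ] Plane) (c : Plane) :
    ∫ z in Metric.closedBall (0 : Plane) 1, inner ℝ (A z) c / ‖A z‖ = 0 := by
  have h := setIntegral_closedBall_comp_isometry (LinearIsometryEquiv.neg ℝ)
    (fun z => inner ℝ (A z) c / ‖A z‖) 1
  simp only [LinearIsometryEquiv.coe_neg, map_neg, inner_neg_left, norm_neg, neg_div,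
    integral_neg] at h
  linarith

/-- The power `ρ⁵` collects `ρ²` from the area, `ρ` from the factored norm and `ρ²` from the
normalisation of the remainder. The constant `K` contains all terms free of `c`; the term linear in
`c` is odd in `z` and drops out. -/
lemma exists_medianFunctional_eq (hρ : 0 < ρ) (hu : ContinuousOn u (Metric.closedBall x ρ)) :
    ∃ K : ℝ, ∀ c, medianFunctional u x ρ (u x + ρ ^ 2 • c)
      = ρ ^ 5 * scaledMedianFunctional u x ρ c + K := by
  set A := fderiv ℝ u x with hA
  set h := secondOrderRemainder u x ρ with hh
  have hcont := continuousOn_secondOrderRemainder hρ hu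
  rw [← hh] at hcont
  refine ⟨ρ ^ 3 * (∫ z in Metric.closedBall (0 : Plane) 1, (‖A z‖ + ρ * (inner ℝ (A z) (h z) / ‖A z‖))),
    fun c => ?_⟩
  have hnorm : ∀ z, ‖u (x + ρ • z) - (u x + ρ ^ 2 • c)‖
      = ρ * (normRemainder (A z) (ρ • (h z - c)) + (‖A z‖ + ρ * (inner ℝ (A z) (h z) / ‖A z‖))
        - ρ * (inner ℝ (A z) c / ‖A z‖)) := by
    intro z
    have : u (x + ρ • z) - (u x + ρ ^ 2 • c) = ρ • (A z + ρ • (h z - c)) := by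
      have hz : ρ ^ 2 • h z = u (x + ρ • z) - u x - ρ • A z := by
        rw [hh, secondOrderRemainder, smul_smul, mul_inv_cancel₀ (by positivity), one_smul]
      rw [smul_add, smul_smul, ← pow_two, smul_sub, hz]
      abel
    rw [this, norm_smul, Real.norm_of_nonneg hρ.le, normRemainder, inner_smul_right, inner_sub_right]
    ring
  have h1 : IntegrableOn (fun z => normRemainder (A z) (ρ • (h z - c))) (Metric.closedBall 0 1) :=
    integrableOn_normRemainder A (by fun_prop)
  have h2 : IntegrableOn (fun z => ‖A z‖ + ρ * (inner ℝ (A z) (h z) / ‖A z‖))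
      (Metric.closedBall 0 1) :=
    (A.continuous.continuousOn.norm.integrableOn_compact (isCompact_closedBall 0 1)).add
      ((integrableOn_inner_div_norm A hcont).const_mul ρ)
  have h3 : IntegrableOn (fun z => ρ * (inner ℝ (A z) c / ‖A z‖)) (Metric.closedBall 0 1) :=
    (integrableOn_inner_div_norm A continuousOn_const).const_mul ρ
  have h12 : IntegrableOn (fun z => normRemainder (A z) (ρ • (h z - c))
      + (‖A z‖ + ρ * (inner ℝ (A z) (h z) / ‖A z‖))) (Metric.closedBall 0 1) := h1.add h2
  rw [medianFunctional, setIntegral_closedBall_eq_unit _ _ hρ]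
  simp only [hnorm]
  rw [integral_const_mul, integral_sub h12 h3, integral_add h1 h2, integral_const_mul ρ,
    integral_inner_div_norm_eq_zero, scaledMedianFunctional, integral_const_mul, ← hA, ← hh]
  field_simp
  ring

lemma convexOn_scaledMedianFunctional (hρ : 0 < ρ) (hu : ContinuousOn u (Metric.closedBall x ρ)) :
    ConvexOn ℝ Set.univ (scaledMedianFunctional u x ρ) := by
  obtain ⟨K, hK⟩ := exists_medianFunctional_eq hρ hu
  refine ⟨convex_univ, fun c _ d _ a b ha hb hab => ?_⟩
  have h := (convexOn_medianFunctional hu).2 (Set.mem_univ (u x + ρ ^ 2 • c))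
    (Set.mem_univ (u x + ρ ^ 2 • d)) ha hb hab
  have heq : a • (u x + ρ ^ 2 • c) + b • (u x + ρ ^ 2 • d) = u x + ρ ^ 2 • (a • c + b • d) := by
    calc _ = (a + b) • u x + ρ ^ 2 • (a • c + b • d) := by module
      _ = _ := by rw [hab, one_smul]
  rw [heq, hK, hK, hK] at h
  simp only [smul_eq_mul] at h ⊢
  have h5 : 0 < ρ ^ 5 := by positivity
  have : K = (a + b) * K := by rw [hab, one_mul]
  rw [← mul_le_mul_iff_right₀ h5]
  linarith

lemma IsL1MedianOnDisc.scaled_le (hρ : 0 < ρ) (hu : ContinuousOn u (Metric.closedBall x ρ))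
    {m : Plane} (hm : IsL1MedianOnDisc u x ρ m) (c : Plane) :
    scaledMedianFunctional u x ρ ((ρ ^ 2)⁻¹ • (m - u x)) ≤ scaledMedianFunctional u x ρ c := by
  obtain ⟨K, hK⟩ := exists_medianFunctional_eq hρ hu
  have h : medianFunctional u x ρ m ≤ medianFunctional u x ρ (u x + ρ ^ 2 • c) := hm _
  have hmc : m = u x + ρ ^ 2 • ((ρ ^ 2)⁻¹ • (m - u x)) := by
    rw [smul_smul, mul_inv_cancel₀ (by positivity), one_smul]
    abel
  rw [hmc, hK, hK] at h
  have h5 : 0 < ρ ^ 5 := by positivity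
  rw [← mul_le_mul_iff_right₀ h5]
  linarith

lemma ContDiffAt.eventually_norm_secondOrderRemainder_sub_le (hu : ContDiffAt ℝ 2 u x) {ε : ℝ}
    (hε : 0 < ε) : ∀ᶠ ρ in 𝓝[>] (0 : ℝ), ∀ z ∈ Metric.closedBall (0 : Plane) 1,
      ‖secondOrderRemainder u x ρ z - (1 / 2 : ℝ) • fderiv ℝ (fderiv ℝ u) x z z‖ ≤ ε := by
  obtain ⟨δ, hδ, h⟩ := hu.eventually_norm_taylor_two_le hε
  filter_upwards [Ioc_mem_nhdsGT hδ] with ρ hρ z hz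
  rw [mem_closedBall_zero_iff] at hz
  have hρ0 : 0 < ρ := hρ.1
  have hn : ‖ρ • z‖ ≤ ρ := by
    rw [norm_smul, Real.norm_of_nonneg hρ0.le]
    nlinarith
  have h1 := h (ρ • z) (hn.trans hρ.2)
  have heq : secondOrderRemainder u x ρ z - (1 / 2 : ℝ) • fderiv ℝ (fderiv ℝ u) x z z
      = (ρ ^ 2)⁻¹ • (u (x + ρ • z) - u x - fderiv ℝ u x (ρ • z)
        - (1 / 2 : ℝ) • fderiv ℝ (fderiv ℝ u) x (ρ • z) (ρ • z)) := by
    rw [secondOrderRemainder]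
    simp only [map_smul, smul_apply, smul_sub, smul_smul]
    congr 2
    field_simp
  rw [heq, norm_smul, norm_inv, norm_pow, Real.norm_of_nonneg hρ0.le]
  calc (ρ ^ 2)⁻¹ * _ ≤ (ρ ^ 2)⁻¹ * (ε * ‖ρ • z‖ ^ 2) := by gcongr
    _ ≤ (ρ ^ 2)⁻¹ * (ε * ρ ^ 2) := by gcongr
    _ = ε := by field_simp

lemma eventually_continuousOn_closedBall (hu : ContDiffAt ℝ 2 u x) :
    ∀ᶠ ρ in 𝓝[>] (0 : ℝ), ContinuousOn u (Metric.closedBall x ρ) := by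
  have hc : ∀ᶠ y in 𝓝 x, ContinuousAt u y :=
    (hu.eventually (by simp)).mono fun y hy => hy.continuousAt
  obtain ⟨δ, hδ, h⟩ := Metric.eventually_nhds_iff_ball.1 hc
  filter_upwards [Ioo_mem_nhdsGT hδ] with ρ hρ y hy
  exact (h y (Metric.closedBall_subset_ball hρ.2 hy)).continuousWithinAt

lemma tendsto_scaledMedianFunctional (hu : ContDiffAt ℝ 2 u x)
    (hinj : Function.Injective (fderiv ℝ u x)) (c₀ : Plane) :
    Tendsto (fun q : ℝ × Plane => scaledMedianFunctional u x q.1 q.2) (𝓝[>] 0 ×ˢ 𝓝 c₀)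
      (𝓝 (limitMedianFunctional (fderiv ℝ u x)
        (fun z => (1 / 2 : ℝ) • fderiv ℝ (fderiv ℝ u) x z z) c₀)) := by
  set A := fderiv ℝ u x with hA
  set B := fderiv ℝ (fderiv ℝ u) x with hB
  -- An injective linear map in finite dimension is bounded below, so `‖A z‖⁻¹ ≤ k ‖z‖⁻¹`.
  obtain ⟨k, -, hk⟩ := A.toLinearMap.exists_antilipschitzWith (LinearMap.ker_eq_bot.2 hinj)
  have hAz : ∀ z, ‖z‖ ≤ k * ‖A z‖ := fun z => by
    simpa using hk.le_mul_dist z 0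
  have hA0 : ∀ z, z ≠ 0 → A z ≠ 0 := fun z hz h => hz (hinj (h.trans (map_zero A).symm))
  have hfst : Tendsto (fun q : ℝ × Plane => q.1) (𝓝[>] 0 ×ˢ 𝓝 c₀) (𝓝[>] 0) := tendsto_fst
  have hpos : ∀ᶠ q : ℝ × Plane in 𝓝[>] 0 ×ˢ 𝓝 c₀, 0 < q.1 := hfst.eventually self_mem_nhdsWithin
  have hcont := hfst.eventually (eventually_continuousOn_closedBall hu)
  have hrem := hfst.eventually (hu.eventually_norm_secondOrderRemainder_sub_le one_pos)
  have hsnd : ∀ᶠ q : ℝ × Plane in 𝓝[>] 0 ×ˢ 𝓝 c₀, ‖q.2‖ ≤ ‖c₀‖ + 1 :=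
    tendsto_snd.norm.eventually_le_const (by linarith)
  have hball : MeasurableSet (Metric.closedBall (0 : Plane) 1) :=
    Metric.isClosed_closedBall.measurableSet
  have hne : ∀ᵐ z : Plane ∂(volume.restrict (Metric.closedBall (0 : Plane) 1)), z ≠ 0 :=
    ae_restrict_of_ae (Measure.ae_ne volume 0)
  -- Bound for `‖secondOrderRemainder - c‖`: distance to the limit at most `1`, limit at most `‖B‖`,
  -- and `‖c‖ ≤ ‖c₀‖ + 1` near `c₀`.
  set C := 1 + ‖B‖ + (‖c₀‖ + 1) with hC
  refine tendsto_integral_filter_of_dominated_convergence (fun z => C ^ 2 / 2 * (k * ‖z‖⁻¹))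
    ?_ ?_ ?_ ?_
  · filter_upwards [hpos, hcont] with q hq hq'
    have := continuousOn_secondOrderRemainder hq hq'
    exact ((integrableOn_normRemainder A (by fun_prop)).const_mul _).aestronglyMeasurable
  · filter_upwards [hpos, hrem, hsnd] with q hq hr hs
    filter_upwards [hne, ae_restrict_mem hball] with z hz hzb
    have hz0 : 0 < ‖z‖ := norm_pos_iff.2 hz
    have hv0 : 0 < ‖A z‖ := norm_pos_iff.2 (hA0 z hz)
    have hz1 : ‖z‖ ≤ 1 := mem_closedBall_zero_iff.1 hzb
    refine (abs_inv_sq_mul_normRemainder_le (hA0 z hz) hq.ne' _).trans ?_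
    have hBz : ‖(1 / 2 : ℝ) • B z z‖ ≤ ‖B‖ := by
      have h1 : ‖B z z‖ ≤ ‖B‖ * ‖z‖ * ‖z‖ := B.le_opNorm₂ z z
      have h2 : ‖B‖ * ‖z‖ * ‖z‖ ≤ ‖B‖ * 1 * 1 := by gcongr
      rw [norm_smul]
      norm_num
      linarith [norm_nonneg (B z z)]
    have hle : ‖secondOrderRemainder u x q.1 z - q.2‖ ≤ C := by
      have h1 := norm_sub_le (secondOrderRemainder u x q.1 z) q.2
      have h2 := norm_sub_norm_le (secondOrderRemainder u x q.1 z) ((1 / 2 : ℝ) • B z z)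
      have h3 := hr z hzb
      linarith
    have hinv : ‖A z‖⁻¹ ≤ k * ‖z‖⁻¹ := by
      have hk0 : 0 < (k : ℝ) := by
        by_contra! hk0
        have := hAz z
        nlinarith
      rw [inv_le_comm₀ hv0 (by positivity), mul_inv, inv_inv]
      rw [inv_mul_le_iff₀ hk0]
      exact hAz z
    gcongr
  · exact (integrableOn_inv_norm_closedBall.const_mul _).const_mul _
  · filter_upwards [hne, ae_restrict_mem hball] with z hz hzb
    refine tendsto_normRemainder (hA0 z hz) (hfst.mono_right nhdsWithin_le_nhds)
      (hpos.mono fun q hq => hq.ne') (Tendsto.sub ?_ tendsto_snd)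
    refine Tendsto.comp (f := Prod.fst) (g := fun r => secondOrderRemainder u x r z) ?_ hfst
    rw [Metric.tendsto_nhds]
    intro ε hε
    filter_upwards [hu.eventually_norm_secondOrderRemainder_sub_le (half_pos hε)] with r hr
    rw [dist_eq_norm]
    exact (hr z hzb).trans_lt (half_lt_self hε)

/-- If the limit functional has a strict global minimum, then it is the limit of the rescaled
medians. -/
lemma tendsto_scaled_median (hu : ContDiffAt ℝ 2 u x) (hinj : Function.Injective (fderiv ℝ u x))
    {c₀ : Plane} (hmin : ∀ c, c ≠ c₀ →
      limitMedianFunctional (fderiv ℝ u x) (fun z => (1 / 2 : ℝ) • fderiv ℝ (fderiv ℝ u) x z z) c₀ <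
      limitMedianFunctional (fderiv ℝ u x) (fun z => (1 / 2 : ℝ) • fderiv ℝ (fderiv ℝ u) x z z) c)
    {M : ℝ → Plane} (hM : ∀ᶠ ρ in 𝓝[>] (0 : ℝ), IsL1MedianOnDisc u x ρ (M ρ)) :
    (fun ρ : ℝ => M ρ - (u x + ρ ^ 2 • c₀)) =o[𝓝[>] (0 : ℝ)] (fun ρ : ℝ => ρ ^ 2) := by
  have hpos : ∀ᶠ ρ : ℝ in 𝓝[>] 0, 0 < ρ := self_mem_nhdsWithin
  have hcont := eventually_continuousOn_closedBall hu
  have hlim : Tendsto (fun ρ => (ρ ^ 2)⁻¹ • (M ρ - u x)) (𝓝[>] (0 : ℝ)) (𝓝 c₀) := by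
    refine tendsto_minimizer_of_convexOn ?_ (tendsto_scaledMedianFunctional hu hinj) hmin ?_
    · filter_upwards [hpos, hcont] with ρ hρ hc
      exact convexOn_scaledMedianFunctional hρ hc
    · filter_upwards [hpos, hcont, hM] with ρ hρ hc hm
      exact hm.scaled_le hρ hc c₀
  rw [isLittleO_iff]
  intro ε hε
  filter_upwards [hpos, hlim (Metric.closedBall_mem_nhds c₀ hε)] with ρ hρ hd
  rw [Set.mem_preimage, mem_closedBall_iff_norm] at hd
  have heq : M ρ - (u x + ρ ^ 2 • c₀) = ρ ^ 2 • ((ρ ^ 2)⁻¹ • (M ρ - u x) - c₀) := by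
    rw [smul_sub, smul_smul, mul_inv_cancel₀ (by positivity), one_smul]
    abel
  rw [heq, norm_smul, mul_comm]
  gcongr

end Scaling

/-! ### Minimiser of the limit functional -/

/-- The limit functional in coordinates: `(p₁, p₂)`, `(q₁, q₂)`, `(r₁, r₂)` are the coefficients of
the quadratic form `½ (p s² + 2 q s t + r t²)`. -/
noncomputable def quadraticIntegrand (l p₁ p₂ q₁ q₂ r₁ r₂ c₁ c₂ : ℝ) (z : Plane) : ℝ :=
  (z 0 * ((p₂ * z 0 ^ 2 + 2 * q₂ * (z 0 * z 1) + r₂ * z 1 ^ 2) / 2 - c₂)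
    - l * z 1 * ((p₁ * z 0 ^ 2 + 2 * q₁ * (z 0 * z 1) + r₁ * z 1 ^ 2) / 2 - c₁)) ^ 2
    / (z 0 ^ 2 + l ^ 2 * z 1 ^ 2) ^ (3 / 2 : ℝ)

lemma integrableOn_quadraticIntegrand {l : ℝ} (hl : 0 < l) (p₁ p₂ q₁ q₂ r₁ r₂ c₁ c₂ : ℝ) :
    IntegrableOn (quadraticIntegrand l p₁ p₂ q₁ q₂ r₁ r₂ c₁ c₂)
      (Metric.closedBall (0 : Plane) 1) := by
  set f₁ : Plane → ℝ := fun z =>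
    (p₁ * z 0 ^ 2 + 2 * q₁ * (z 0 * z 1) + r₁ * z 1 ^ 2) / 2 - c₁ with hf₁
  set f₂ : Plane → ℝ := fun z =>
    (p₂ * z 0 ^ 2 + 2 * q₂ * (z 0 * z 1) + r₂ * z 1 ^ 2) / 2 - c₂ with hf₂
  have hc₁ : Continuous f₁ := by rw [hf₁]; fun_prop
  have hc₂ : Continuous f₂ := by rw [hf₂]; fun_prop
  have hK := isCompact_closedBall (0 : Plane) 1
  have h20 := (integrableOn_ellipticIntegrand (i := 2) (j := 0) le_rfl hl).mul_continuousOn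
    (hc₂.pow 2).continuousOn hK
  have h11 := (integrableOn_ellipticIntegrand (i := 1) (j := 1) le_rfl hl).mul_continuousOn
    ((hc₁.mul hc₂).const_mul (-2 * l)).continuousOn hK
  have h02 := (integrableOn_ellipticIntegrand (i := 0) (j := 2) le_rfl hl).mul_continuousOn
    ((hc₁.pow 2).const_mul (l ^ 2)).continuousOn hK
  refine ((h20.add h11).add h02).congr (Eventually.of_forall fun z => ?_)
  simp only [Pi.add_apply, Pi.mul_apply, Pi.pow_apply, ellipticIntegrand, quadraticIntegrand, hf₁, hf₂]
  ring

lemma ellipticIntegral_eq_zero_of_odd (i j : ℕ) (hj : Odd j) (l : ℝ) :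
    ellipticIntegral i j l = 0 := by
  set e : Plane ≃ₗᵢ[ℝ] Plane := LinearIsometryEquiv.piLpCongrRight 2
    ![LinearIsometryEquiv.refl ℝ ℝ, LinearIsometryEquiv.neg ℝ] with he
  have h0 : ∀ z, e z 0 = z 0 := fun z => by simp [he]
  have h1 : ∀ z, e z 1 = -z 1 := fun z => by simp [he]
  have h := setIntegral_closedBall_comp_isometry e (ellipticIntegrand i j l) 1
  have hneg : ∀ z, ellipticIntegrand i j l (e z) = -ellipticIntegrand i j l z := fun z => by
    simp only [ellipticIntegrand, h0, h1, hj.neg_pow, neg_sq]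
    ring
  simp only [hneg, integral_neg] at h
  rw [ellipticIntegral]
  linarith

/-- Completing the square. The hypotheses say that the gradient vanishes at `(c₁, c₂)`; the mixed
term in `d₁ d₂` carries `ellipticIntegral 1 1`, which is zero by the reflection `t ↦ -t`. -/
lemma integral_quadraticIntegrand_add {l : ℝ} (hl : 0 < l) {p₁ p₂ q₁ q₂ r₁ r₂ c₁ c₂ : ℝ}
    (h₁ : p₁ * ellipticIntegral 2 2 l + r₁ * ellipticIntegral 0 4 l
      - 2 * c₁ * ellipticIntegral 0 2 l = 2 * l⁻¹ * q₂ * ellipticIntegral 2 2 l)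
    (h₂ : p₂ * ellipticIntegral 4 0 l + r₂ * ellipticIntegral 2 2 l
      - 2 * c₂ * ellipticIntegral 2 0 l = 2 * l * q₁ * ellipticIntegral 2 2 l) (d₁ d₂ : ℝ) :
    ∫ z in Metric.closedBall (0 : Plane) 1,
        quadraticIntegrand l p₁ p₂ q₁ q₂ r₁ r₂ (c₁ + d₁) (c₂ + d₂) z
      = (∫ z in Metric.closedBall (0 : Plane) 1, quadraticIntegrand l p₁ p₂ q₁ q₂ r₁ r₂ c₁ c₂ z)
        + (d₂ ^ 2 * ellipticIntegral 2 0 l + l ^ 2 * d₁ ^ 2 * ellipticIntegral 0 2 l) := by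
  have step : ∀ {f : Plane → ℝ} {I : ℝ}, (IntegrableOn f (Metric.closedBall 0 1) ∧
      ∫ z in Metric.closedBall (0 : Plane) 1, f z = I) → ∀ (a : ℝ) (i j : ℕ), 2 ≤ i + j →
      (IntegrableOn (fun z => f z + a * ellipticIntegrand i j l z) (Metric.closedBall 0 1) ∧
      ∫ z in Metric.closedBall (0 : Plane) 1, (f z + a * ellipticIntegrand i j l z)
        = I + a * ellipticIntegral i j l) := by
    rintro f I ⟨hf, rfl⟩ a i j hij
    have hi := (integrableOn_ellipticIntegrand hij hl).const_mul a
    exact ⟨hf.add hi, by rw [integral_add hf hi, integral_const_mul]; rfl⟩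
  have hpt : ∀ z, quadraticIntegrand l p₁ p₂ q₁ q₂ r₁ r₂ (c₁ + d₁) (c₂ + d₂) z
      = ((((((((quadraticIntegrand l p₁ p₂ q₁ q₂ r₁ r₂ c₁ c₂ z
        + (-(p₂ * d₂)) * ellipticIntegrand 4 0 l z)
        + (l * p₁ * d₂ - 2 * q₂ * d₂ + l * p₂ * d₁) * ellipticIntegrand 3 1 l z)
        + (2 * l * q₁ * d₂ - r₂ * d₂ + 2 * l * q₂ * d₁ - l ^ 2 * p₁ * d₁)
          * ellipticIntegrand 2 2 l z)
        + (l * r₁ * d₂ + l * r₂ * d₁ - 2 * l ^ 2 * q₁ * d₁) * ellipticIntegrand 1 3 l z)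
        + (-(l ^ 2 * r₁ * d₁)) * ellipticIntegrand 0 4 l z)
        + (2 * c₂ * d₂ + d₂ ^ 2) * ellipticIntegrand 2 0 l z)
        + (-(2 * l * (c₁ * d₂ + c₂ * d₁ + d₁ * d₂))) * ellipticIntegrand 1 1 l z)
        + l ^ 2 * (2 * c₁ * d₁ + d₁ ^ 2) * ellipticIntegrand 0 2 l z) := fun z => by
    simp only [ellipticIntegrand, quadraticIntegrand]
    ring
  have base := step (step (step (step (step (step (step (step
    ⟨integrableOn_quadraticIntegrand hl p₁ p₂ q₁ q₂ r₁ r₂ c₁ c₂, rfl⟩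
    (-(p₂ * d₂)) 4 0 (by norm_num))
    (l * p₁ * d₂ - 2 * q₂ * d₂ + l * p₂ * d₁) 3 1 (by norm_num))
    (2 * l * q₁ * d₂ - r₂ * d₂ + 2 * l * q₂ * d₁ - l ^ 2 * p₁ * d₁) 2 2 (by norm_num))
    (l * r₁ * d₂ + l * r₂ * d₁ - 2 * l ^ 2 * q₁ * d₁) 1 3 (by norm_num))
    (-(l ^ 2 * r₁ * d₁)) 0 4 (by norm_num))
    (2 * c₂ * d₂ + d₂ ^ 2) 2 0 (by norm_num))
    (-(2 * l * (c₁ * d₂ + c₂ * d₁ + d₁ * d₂))) 1 1 (by norm_num))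
    (l ^ 2 * (2 * c₁ * d₁ + d₁ ^ 2)) 0 2 (by norm_num)
  simp only [hpt]
  rw [base.2, ellipticIntegral_eq_zero_of_odd 3 1 (by decide) l,
    ellipticIntegral_eq_zero_of_odd 1 3 (by decide) l,
    ellipticIntegral_eq_zero_of_odd 1 1 (by decide) l]
  have hl' : l * l⁻¹ = 1 := mul_inv_cancel₀ hl.ne'
  have h₁' := congrArg (fun t => l ^ 2 * t) h₁
  rw [show ∀ t : ℝ, l ^ 2 * (2 * l⁻¹ * q₂ * t) = (l * l⁻¹) * (2 * l * q₂ * t) by intro t; ring,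
    hl', one_mul] at h₁'
  linear_combination -d₁ * h₁' - d₂ * h₂

/-- The linear isometry mapping the standard frame to an orthonormal frame. -/
lemma exists_frame_isometry {η ξ : Plane} (hη : ‖η‖ = 1) (hξ : ‖ξ‖ = 1) (h : inner ℝ η ξ = 0) :
    ∃ e : Plane ≃ₗᵢ[ℝ] Plane, ∀ z, e z = z 0 • η + z 1 • ξ := by
  have hon : Orthonormal ℝ ![η, ξ] := by
    rw [orthonormal_iff_ite]
    intro i j
    have h' : inner ℝ ξ η = 0 := by rw [real_inner_comm]; exact h
    fin_cases i <;> fin_cases j <;> simp [hη, hξ, h, h']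
  set b := (basisOfOrthonormalOfCardEqFinrank hon (by simp)).toOrthonormalBasis
    (by simpa using hon) with hb
  refine ⟨b.repr.symm, fun z => ?_⟩
  rw [← b.sum_repr_symm]
  simp [hb, Fin.sum_univ_two]

/-- Lagrange's identity turns `‖v‖² ‖a‖² - ⟨v, a⟩²` into the square of the planar cross product,
evaluated in the frame `(η, ξ)` of the domain and `(e₁, e₂)` of the values, where `A` is diagonal.
-/
lemma limitMedianFunctional_eq (A : Plane →L[ℝ] Plane) (B : Plane →L[ℝ] Plane →L[ℝ] Plane)
    (hB : ∀ a b, B a b = B b a) {η ξ e₁ e₂ : Plane} (hη : ‖η‖ = 1) (hξ : ‖ξ‖ = 1)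
    (hηξ : inner ℝ η ξ = 0) (he₁ : ‖e₁‖ = 1) (he₂ : ‖e₂‖ = 1) (he : inner ℝ e₁ e₂ = 0)
    {σ₁ σ₂ : ℝ} (hσ₁ : 0 < σ₁) (hσ₂ : 0 < σ₂) (hAη : A η = σ₁ • e₁) (hAξ : A ξ = σ₂ • e₂)
    (c : Plane) :
    limitMedianFunctional A (fun z => (1 / 2 : ℝ) • B z z) c = (2 * σ₁)⁻¹ *
      ∫ z in Metric.closedBall (0 : Plane) 1, quadraticIntegrand (σ₂ / σ₁)
        (inner ℝ e₁ (B η η)) (inner ℝ e₂ (B η η)) (inner ℝ e₁ (B η ξ)) (inner ℝ e₂ (B η ξ))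
        (inner ℝ e₁ (B ξ ξ)) (inner ℝ e₂ (B ξ ξ)) (inner ℝ e₁ c) (inner ℝ e₂ c) z := by
  obtain ⟨F, hF⟩ := exists_frame_isometry hη hξ hηξ
  obtain ⟨E, hE⟩ := exists_frame_isometry he₁ he₂ he
  rw [limitMedianFunctional, ← setIntegral_closedBall_comp_isometry F, ← integral_const_mul]
  congr 1
  ext z
  have he' : inner ℝ e₂ e₁ = 0 := by rw [real_inner_comm]; exact he
  have hAF : A (F z) = E !₂[σ₁ * z 0, σ₂ * z 1] := by
    rw [hF, hE]
    simp [hAη, hAξ, smul_smul, mul_comm]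
  have hrep : ∀ a : Plane, a = E !₂[inner ℝ e₁ a, inner ℝ e₂ a] := fun a => by
    obtain ⟨w, rfl⟩ := E.surjective a
    congr 1
    rw [hE]
    ext i
    fin_cases i <;>
    simp [inner_add_right, inner_smul_right, he₁, he₂, he, he']
  have hBF : B (F z) (F z) = z 0 ^ 2 • B η η + (2 * (z 0 * z 1)) • B η ξ + z 1 ^ 2 • B ξ ξ := by
    rw [hF]
    simp only [map_add, map_smul, add_apply, smul_apply, smul_add, smul_smul,
      hB ξ η]
    module
  set a : Plane := (1 / 2 : ℝ) • B (F z) (F z) - c with ha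
  have ha₁ : ∀ e : Plane, inner ℝ e a = (inner ℝ e (B η η) * z 0 ^ 2
      + 2 * inner ℝ e (B η ξ) * (z 0 * z 1) + inner ℝ e (B ξ ξ) * z 1 ^ 2) / 2 - inner ℝ e c :=
    fun e => by
    rw [ha, hBF, inner_sub_right, inner_smul_right, inner_add_right, inner_add_right,
      inner_smul_right, inner_smul_right, inner_smul_right]
    ring
  have hsq : ∀ w : Plane, ‖E w‖ ^ 2 = w 0 ^ 2 + w 1 ^ 2 := fun w => by
    rw [E.norm_map, Plane.norm_sq]
  have hnum : ‖A (F z)‖ ^ 2 * ‖a‖ ^ 2 - inner ℝ (A (F z)) a ^ 2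
      = (σ₁ * z 0 * inner ℝ e₂ a - σ₂ * z 1 * inner ℝ e₁ a) ^ 2 := by
    have hra := hrep a
    generalize inner ℝ e₁ a = α at hra ⊢
    generalize inner ℝ e₂ a = β at hra ⊢
    rw [hAF, hra, E.inner_map_map, hsq, hsq, Plane.inner_eq]
    simp only [Matrix.cons_val_zero, Matrix.cons_val_one]
    ring
  have hden : ‖A (F z)‖ = σ₁ * √(z 0 ^ 2 + (σ₂ / σ₁) ^ 2 * z 1 ^ 2) := by
    rw [← sq_eq_sq₀ (norm_nonneg _) (by positivity), hAF, hsq, mul_pow,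
      Real.sq_sqrt (by positivity)]
    simp only [Matrix.cons_val_zero, Matrix.cons_val_one]
    field_simp
  rw [hnum, hden, quadraticIntegrand, ← ha₁, ← ha₁, rpow_three_halves (by positivity)]
  rw [show σ₁ * z 0 * inner ℝ e₂ a - σ₂ * z 1 * inner ℝ e₁ a
    = σ₁ * (z 0 * inner ℝ e₂ a - σ₂ / σ₁ * z 1 * inner ℝ e₁ a) by field_simp]
  rw [mul_pow σ₁, mul_pow σ₁, show 2 * (σ₁ ^ 3 * √(z 0 ^ 2 + (σ₂ / σ₁) ^ 2 * z 1 ^ 2) ^ 3)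
    = σ₁ ^ 2 * ((2 * σ₁) * √(z 0 ^ 2 + (σ₂ / σ₁) ^ 2 * z 1 ^ 2) ^ 3) by ring,
    mul_div_mul_left _ _ (by positivity), inv_mul_eq_div, div_div, mul_comm (2 * σ₁)]

/-! ### Frames and coefficient matrices -/

lemma frameMatrix_transpose_mul_self {a b : Plane} (ha : ‖a‖ = 1) (hb : ‖b‖ = 1)
    (hab : inner ℝ a b = 0) : (frameMatrix a b)ᵀ * frameMatrix a b = 1 := by
  have h1 := Plane.norm_sq a
  have h2 := Plane.norm_sq b
  rw [Plane.inner_eq] at hab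
  rw [ha] at h1
  rw [hb] at h2
  ext i j
  fin_cases i <;> fin_cases j <;> simp [frameMatrix, Matrix.mul_apply, Fin.sum_univ_two] <;> linarith

lemma frameMatrix_transpose_mulVec (a b w : Plane) :
    (frameMatrix a b)ᵀ *ᵥ w.ofLp = ![inner ℝ a w, inner ℝ b w] := by
  ext i
  fin_cases i <;>
    simp [frameMatrix, Matrix.mulVec, dotProduct, Fin.sum_univ_two, Plane.inner_eq]

lemma jacobianMatrix_mulVec (u : Plane → Plane) (x a : Plane) :
    jacobianMatrix u x *ᵥ a.ofLp = (fderiv ℝ u x a).ofLp := by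
  have ha : a = a 0 • EuclideanSpace.single 0 1 + a 1 • EuclideanSpace.single 1 1 := by
    ext i; fin_cases i <;> simp
  conv_rhs => rw [ha]
  ext i
  simp [jacobianMatrix, dirDeriv, Matrix.mulVec, dotProduct, Fin.sum_univ_two, mul_comm]

lemma inner_fderiv_eq (u : Plane → Plane) (x a b : Plane) :
    inner ℝ (fderiv ℝ u x a) (fderiv ℝ u x b)
      = a.ofLp ⬝ᵥ (structureTensor u x *ᵥ b.ofLp) := by
  rw [structureTensor, ← Matrix.mulVec_mulVec, jacobianMatrix_mulVec, Matrix.dotProduct_mulVec,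
    Matrix.vecMul_transpose, jacobianMatrix_mulVec, Plane.inner_eq]
  simp [dotProduct, Fin.sum_univ_two]

lemma injective_fderiv_of_det_ne_zero {u : Plane → Plane} {x : Plane}
    (h : (jacobianMatrix u x).det ≠ 0) : Function.Injective (fderiv ℝ u x) := by
  refine (injective_iff_map_eq_zero _).2 fun a ha => ?_
  have h1 := jacobianMatrix_mulVec u x a
  rw [ha] at h1
  have h2 := Matrix.eq_zero_of_mulVec_eq_zero h h1
  ext i
  exact congrFun h2 i

section Frame

variable {u : Plane → Plane} {x η ξ : Plane}

/-- The inner product equals `η · J ξ = μ₂ (η · ξ)`. -/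
lemma IsMajorMinorEigenframe.inner_dirDeriv_eq_zero
    (h : IsMajorMinorEigenframe (structureTensor u x) η ξ) :
    inner ℝ (dirDeriv η u x) (dirDeriv ξ u x) = 0 := by
  obtain ⟨μ₁, μ₂, -, -, h2⟩ := h.eigen
  have ho := h.orthogonal
  rw [Plane.inner_eq] at ho
  rw [dirDeriv, dirDeriv, inner_fderiv_eq, h2, dotProduct_smul]
  simp only [dotProduct, Fin.sum_univ_two, smul_eq_mul]
  rw [ho, mul_zero]

lemma norm_dirDeriv_pos (hdet : (jacobianMatrix u x).det ≠ 0) {a : Plane} (ha : ‖a‖ = 1) :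
    0 < ‖dirDeriv a u x‖ := by
  rw [norm_pos_iff, dirDeriv]
  intro h0
  have := injective_fderiv_of_det_ne_zero hdet (h0.trans (map_zero _).symm)
  simp [this] at ha

/-- The normalised directional derivative. -/
noncomputable def unitDirDeriv (a : Plane) (u : Plane → Plane) (x : Plane) : Plane :=
  ‖dirDeriv a u x‖⁻¹ • dirDeriv a u x

lemma norm_unitDirDeriv (hdet : (jacobianMatrix u x).det ≠ 0) {a : Plane} (ha : ‖a‖ = 1) :
    ‖unitDirDeriv a u x‖ = 1 := by
  have := norm_dirDeriv_pos hdet ha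
  rw [unitDirDeriv, norm_smul, norm_inv, norm_norm, inv_mul_cancel₀ this.ne']

lemma dirDeriv_eq_smul_unitDirDeriv (hdet : (jacobianMatrix u x).det ≠ 0) {a : Plane}
    (ha : ‖a‖ = 1) : dirDeriv a u x = ‖dirDeriv a u x‖ • unitDirDeriv a u x := by
  have := norm_dirDeriv_pos hdet ha
  rw [unitDirDeriv, smul_smul, mul_inv_cancel₀ this.ne', one_smul]

lemma IsMajorMinorEigenframe.inner_unitDirDeriv_eq_zero
    (h : IsMajorMinorEigenframe (structureTensor u x) η ξ) :
    inner ℝ (unitDirDeriv η u x) (unitDirDeriv ξ u x) = 0 := by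
  rw [unitDirDeriv, unitDirDeriv, inner_smul_left, inner_smul_right, h.inner_dirDeriv_eq_zero]
  simp

lemma jacobianMatrix_mul_frameMatrix (hdet : (jacobianMatrix u x).det ≠ 0) (hη : ‖η‖ = 1)
    (hξ : ‖ξ‖ = 1) : jacobianMatrix u x * frameMatrix η ξ
      = frameMatrix (unitDirDeriv η u x) (unitDirDeriv ξ u x) *
        Matrix.diagonal ![‖dirDeriv η u x‖, ‖dirDeriv ξ u x‖] := by
  have h1 : ∀ i, (jacobianMatrix u x *ᵥ η.ofLp) i = ‖dirDeriv η u x‖ * unitDirDeriv η u x i :=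
    fun i => by
      rw [jacobianMatrix_mulVec, ← dirDeriv, dirDeriv_eq_smul_unitDirDeriv hdet hη]
      simp [norm_smul, norm_unitDirDeriv hdet hη]
  have h2 : ∀ i, (jacobianMatrix u x *ᵥ ξ.ofLp) i = ‖dirDeriv ξ u x‖ * unitDirDeriv ξ u x i :=
    fun i => by
      rw [jacobianMatrix_mulVec, ← dirDeriv, dirDeriv_eq_smul_unitDirDeriv hdet hξ]
      simp [norm_smul, norm_unitDirDeriv hdet hξ]
  simp only [Matrix.mulVec, dotProduct, Fin.sum_univ_two] at h1 h2
  ext i j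
  fin_cases j
  · have := h1 i
    fin_cases i <;>
    simpa [frameMatrix, Matrix.mul_apply, Fin.sum_univ_two, Matrix.diagonal, mul_comm] using this
  · have := h2 i
    fin_cases i <;>
    simpa [frameMatrix, Matrix.mul_apply, Fin.sum_univ_two, Matrix.diagonal, mul_comm] using this

/-- This is the singular value decomposition `Du P = E D` with `P` and `E` orthogonal: `Du⁻¹ = P D⁻¹
Eᵀ`, so `(Du⁻¹)ᵀ P D = E`. -/
lemma IsMajorMinorEigenframe.rotationR_eq (hdet : (jacobianMatrix u x).det ≠ 0)
    (h : IsMajorMinorEigenframe (structureTensor u x) η ξ) :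
    rotationR u η ξ x = frameMatrix (unitDirDeriv η u x) (unitDirDeriv ξ u x) := by
  have hη := norm_dirDeriv_pos hdet h.norm_major
  have hξ := norm_dirDeriv_pos hdet h.norm_minor
  have hJP := jacobianMatrix_mul_frameMatrix hdet h.norm_major h.norm_minor
  have hP := frameMatrix_transpose_mul_self h.norm_major h.norm_minor h.orthogonal
  have hE := frameMatrix_transpose_mul_self (norm_unitDirDeriv hdet h.norm_major)
    (norm_unitDirDeriv hdet h.norm_minor) h.inner_unitDirDeriv_eq_zero
  rw [rotationR]
  set P := frameMatrix η ξ
  set E := frameMatrix (unitDirDeriv η u x) (unitDirDeriv ξ u x)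
  set σ₁ := ‖dirDeriv η u x‖
  set σ₂ := ‖dirDeriv ξ u x‖
  set D := Matrix.diagonal ![σ₁, σ₂] with hD
  set D' := Matrix.diagonal ![σ₁⁻¹, σ₂⁻¹] with hD'
  have hDD : D * D' = 1 := by
    rw [hD, hD', Matrix.diagonal_mul_diagonal]
    ext i j
    fin_cases i <;> fin_cases j <;> simp [hη.ne', hξ.ne']
  have hD'D : D' * D = 1 := mul_eq_one_comm.1 hDD
  have hEE : E * Eᵀ = 1 := mul_eq_one_comm.1 hE
  have hinv : (jacobianMatrix u x)⁻¹ = P * D' * Eᵀ := by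
    refine Matrix.inv_eq_right_inv ?_
    rw [← mul_assoc, ← mul_assoc, hJP, mul_assoc E, hDD, mul_one, hEE]
  have hD't : D'ᵀ = D' := Matrix.diagonal_transpose _
  rw [hinv, Matrix.transpose_mul, Matrix.transpose_mul, Matrix.transpose_transpose, hD't,
    mul_assoc, mul_assoc, mul_assoc, ← mul_assoc Pᵀ, hP, one_mul, hD'D, mul_one]

lemma IsMajorMinorEigenframe.rotationR_transpose_mul_self (hdet : (jacobianMatrix u x).det ≠ 0)
    (h : IsMajorMinorEigenframe (structureTensor u x) η ξ) :
    (rotationR u η ξ x)ᵀ * rotationR u η ξ x = 1 := by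
  rw [h.rotationR_eq hdet]
  exact frameMatrix_transpose_mul_self (norm_unitDirDeriv hdet h.norm_major)
    (norm_unitDirDeriv hdet h.norm_minor) h.inner_unitDirDeriv_eq_zero

/-- Take determinants in `Du P = R D`, where `det D > 0` and the determinants of `P` and `R` are
`±1`. -/
lemma IsMajorMinorEigenframe.rotationR_det (hdet : (jacobianMatrix u x).det ≠ 0)
    (h : IsMajorMinorEigenframe (structureTensor u x) η ξ) :
    (rotationR u η ξ x).det = Real.sign (jacobianMatrix u x).det * (frameMatrix η ξ).det := by
  have hη := norm_dirDeriv_pos hdet h.norm_major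
  have hξ := norm_dirDeriv_pos hdet h.norm_minor
  have hJP := congrArg Matrix.det
    (jacobianMatrix_mul_frameMatrix hdet h.norm_major h.norm_minor)
  rw [← h.rotationR_eq hdet, Matrix.det_mul, Matrix.det_mul, Matrix.det_diagonal,
    Fin.prod_univ_two] at hJP
  simp only [Matrix.cons_val_zero, Matrix.cons_val_one] at hJP
  have hP := congrArg Matrix.det
    (frameMatrix_transpose_mul_self h.norm_major h.norm_minor h.orthogonal)
  have hR := congrArg Matrix.det (h.rotationR_transpose_mul_self hdet)
  rw [Matrix.det_mul, Matrix.det_transpose, Matrix.det_one, mul_self_eq_one_iff] at hP hR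
  have hs : 0 < ‖dirDeriv η u x‖ * ‖dirDeriv ξ u x‖ := mul_pos hη hξ
  rcases hP with hP | hP <;> rcases hR with hR | hR <;> rw [hP, hR] at hJP <;> rw [hP, hR]
  · rw [Real.sign_of_pos (by linarith), one_mul]
  · rw [Real.sign_of_neg (by linarith), mul_one]
  · rw [Real.sign_of_neg (by linarith), neg_one_mul, neg_neg]
  · rw [Real.sign_of_pos (by linarith), one_mul]

lemma derivRatio_pos (hdet : (jacobianMatrix u x).det ≠ 0) {a b : Plane} (ha : ‖a‖ = 1)
    (hb : ‖b‖ = 1) : 0 < derivRatio u a b x :=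
  div_pos (norm_dirDeriv_pos hdet ha) (norm_dirDeriv_pos hdet hb)

lemma coeffQ₁_ofReal {l : ℝ} (hl : 0 < l) : coeffQ₁ (ENNReal.ofReal l)
    = 3 * ellipticIntegral 2 2 l / ellipticIntegral 2 0 l := by
  rw [coeffQ₁, if_neg (by simpa using hl), if_neg ENNReal.ofReal_ne_top, ENNReal.toReal_ofReal hl.le]

lemma coeffQ₂_ofReal {l : ℝ} (hl : 0 < l) : coeffQ₂ (ENNReal.ofReal l)
    = 3 * ellipticIntegral 0 4 l / ellipticIntegral 0 2 l := by
  rw [coeffQ₂, if_neg (by simpa using hl), if_neg ENNReal.ofReal_ne_top, ENNReal.toReal_ofReal hl.le]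

lemma coeffQ₁_ofReal_inv {l : ℝ} (hl : 0 < l) : coeffQ₁ (ENNReal.ofReal l⁻¹)
    = 3 * ellipticIntegral 2 2 l / ellipticIntegral 0 2 l := by
  have hl' := inv_pos.2 hl
  have := ellipticIntegral_02_pos hl
  rw [coeffQ₁_ofReal hl', ellipticIntegral_swap 2 2 hl', ellipticIntegral_swap 2 0 hl', inv_inv]
  field_simp

lemma coeffQ₂_ofReal_inv {l : ℝ} (hl : 0 < l) : coeffQ₂ (ENNReal.ofReal l⁻¹)
    = 3 * ellipticIntegral 4 0 l / ellipticIntegral 2 0 l := by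
  have hl' := inv_pos.2 hl
  have := ellipticIntegral_20_pos hl
  rw [coeffQ₂_ofReal hl', ellipticIntegral_swap 0 4 hl', ellipticIntegral_swap 0 2 hl', inv_inv]
  field_simp

lemma dirDeriv₂_eq (hu : ContDiffAt ℝ 2 u x) (a b : Plane) :
    dirDeriv₂ a b u x = fderiv ℝ (fderiv ℝ u) x b a := by
  have hd2 : DifferentiableAt ℝ (fderiv ℝ u) x :=
    (hu.fderiv_right (m := 1) (by norm_num)).differentiableAt (by norm_num)
  have h := (hd2.hasFDerivAt.clm_apply (hasFDerivAt_const a x)).fderiv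
  change fderiv ℝ (fun y => fderiv ℝ u y a) x b = _
  rw [h]
  simp

lemma transpose_mulVec_conj_mulVec {R D : Matrix (Fin 2) (Fin 2) ℝ} (hR : Rᵀ * R = 1)
    (w : Fin 2 → ℝ) : Rᵀ *ᵥ ((R * D * Rᵀ) *ᵥ w) = D *ᵥ (Rᵀ *ᵥ w) := by
  rw [Matrix.mulVec_mulVec, Matrix.mulVec_mulVec, mul_assoc, ← mul_assoc, hR, one_mul]

/-- The right-hand side of the PDE system in the frame of normalised directional derivatives. -/
lemma IsMajorMinorEigenframe.inner_medianPdeRhs (hdet : (jacobianMatrix u x).det ≠ 0)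
    (h : IsMajorMinorEigenframe (structureTensor u x) η ξ) :
    inner ℝ (unitDirDeriv η u x) (medianPdeRhs u η ξ x)
      = coeffQ₁ (ENNReal.ofReal (derivRatio u η ξ x))
          * inner ℝ (unitDirDeriv η u x) (dirDeriv₂ η η u x)
        + coeffQ₂ (ENNReal.ofReal (derivRatio u ξ η x))
          * inner ℝ (unitDirDeriv η u x) (dirDeriv₂ ξ ξ u x)
        - 2 * (derivRatio u η ξ x * coeffQ₁ (ENNReal.ofReal (derivRatio u η ξ x))
          * inner ℝ (unitDirDeriv ξ u x) (dirDeriv₂ ξ η u x)) ∧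
    inner ℝ (unitDirDeriv ξ u x) (medianPdeRhs u η ξ x)
      = coeffQ₂ (ENNReal.ofReal (derivRatio u η ξ x))
          * inner ℝ (unitDirDeriv ξ u x) (dirDeriv₂ η η u x)
        + coeffQ₁ (ENNReal.ofReal (derivRatio u ξ η x))
          * inner ℝ (unitDirDeriv ξ u x) (dirDeriv₂ ξ ξ u x)
        - 2 * (derivRatio u ξ η x * coeffQ₁ (ENNReal.ofReal (derivRatio u ξ η x))
          * inner ℝ (unitDirDeriv η u x) (dirDeriv₂ ξ η u x)) := by
  have hR := h.rotationR_transpose_mul_self hdet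
  have key : ∀ w : Plane, (rotationR u η ξ x)ᵀ *ᵥ w.ofLp
      = ![inner ℝ (unitDirDeriv η u x) w, inner ℝ (unitDirDeriv ξ u x) w] := fun w => by
    rw [h.rotationR_eq hdet, frameMatrix_transpose_mulVec]
  have hm := key (medianPdeRhs u η ξ x)
  have hdef : (medianPdeRhs u η ξ x).ofLp = coeffS u η ξ x *ᵥ (dirDeriv₂ η η u x).ofLp
      + coeffT u η ξ x *ᵥ (dirDeriv₂ ξ ξ u x).ofLp
      - (2 : ℝ) • (coeffW u η ξ x *ᵥ (dirDeriv₂ ξ η u x).ofLp) := rfl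
  rw [hdef, Matrix.mulVec_sub, Matrix.mulVec_add, Matrix.mulVec_smul, coeffS, coeffT, coeffW,
    transpose_mulVec_conj_mulVec hR, transpose_mulVec_conj_mulVec hR,
    transpose_mulVec_conj_mulVec hR, key, key, key] at hm
  have h0 := congrFun hm 0
  have h1 := congrFun hm 1
  simp only [Pi.sub_apply, Pi.add_apply, Pi.smul_apply, Matrix.mulVec,
    dotProduct, Fin.sum_univ_two, Matrix.of_apply, Matrix.cons_val_zero, Matrix.cons_val_one,
    Matrix.cons_val', Matrix.cons_val_fin_one, Matrix.diagonal_apply, smul_eq_mul, if_true,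
    zero_ne_one, one_ne_zero, if_false, Fin.isValue] at h0 h1
  constructor
  · linear_combination -h0
  · linear_combination -h1

lemma IsMajorMinorEigenframe.limitMedianFunctional_lt (hu : ContDiffAt ℝ 2 u x)
    (hdet : (jacobianMatrix u x).det ≠ 0)
    (h : IsMajorMinorEigenframe (structureTensor u x) η ξ) {c : Plane}
    (hc : c ≠ (1 / 6 : ℝ) • medianPdeRhs u η ξ x) :
    limitMedianFunctional (fderiv ℝ u x) (fun z => (1 / 2 : ℝ) • fderiv ℝ (fderiv ℝ u) x z z)
      ((1 / 6 : ℝ) • medianPdeRhs u η ξ x) <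
    limitMedianFunctional (fderiv ℝ u x) (fun z => (1 / 2 : ℝ) • fderiv ℝ (fderiv ℝ u) x z z) c := by
  have hσ₁ := norm_dirDeriv_pos hdet h.norm_major
  have hσ₂ := norm_dirDeriv_pos hdet h.norm_minor
  have he₁ := norm_unitDirDeriv hdet h.norm_major
  have he₂ := norm_unitDirDeriv hdet h.norm_minor
  have he := h.inner_unitDirDeriv_eq_zero
  have hsymm : ∀ a b, fderiv ℝ (fderiv ℝ u) x a b = fderiv ℝ (fderiv ℝ u) x b a :=
    hu.isSymmSndFDerivAt (by simp)
  have hlim := limitMedianFunctional_eq (fderiv ℝ u x) (fderiv ℝ (fderiv ℝ u) x) hsymm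
    h.norm_major h.norm_minor h.orthogonal he₁ he₂ he hσ₁ hσ₂
    (dirDeriv_eq_smul_unitDirDeriv hdet h.norm_major)
    (dirDeriv_eq_smul_unitDirDeriv hdet h.norm_minor)
  obtain ⟨hm₁, hm₂⟩ := h.inner_medianPdeRhs hdet
  rw [dirDeriv₂_eq hu, dirDeriv₂_eq hu, dirDeriv₂_eq hu] at hm₁ hm₂
  have hl : 0 < derivRatio u ξ η x := derivRatio_pos hdet h.norm_minor h.norm_major
  -- The integrals are taken at `l = λ⁻¹`, so the coefficients at `λ` are rewritten at `l`; all then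
  -- have denominator `ellipticIntegral 0 2 l` in the `e₁` component and `ellipticIntegral 2 0 l` in
  -- the `e₂` component.
  have hinv : derivRatio u η ξ x = (derivRatio u ξ η x)⁻¹ := by simp [derivRatio]
  rw [hinv, coeffQ₁_ofReal_inv hl, coeffQ₂_ofReal hl] at hm₁
  rw [hinv, coeffQ₂_ofReal_inv hl, coeffQ₁_ofReal hl] at hm₂
  rw [hlim, hlim, ← derivRatio]
  have h02 := ellipticIntegral_02_pos hl
  have h20 := ellipticIntegral_20_pos hl
  set l := derivRatio u ξ η x
  set e₁ := unitDirDeriv η u x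
  set e₂ := unitDirDeriv ξ u x
  set c₀ : Plane := (1 / 6 : ℝ) • medianPdeRhs u η ξ x with hc₀
  set B := fderiv ℝ (fderiv ℝ u) x
  have hc₁ : inner ℝ e₁ c₀ = 1 / 6 * inner ℝ e₁ (medianPdeRhs u η ξ x) := by
    rw [hc₀, inner_smul_right]
  have hc₂ : inner ℝ e₂ c₀ = 1 / 6 * inner ℝ e₂ (medianPdeRhs u η ξ x) := by
    rw [hc₀, inner_smul_right]
  rw [hm₁] at hc₁
  rw [hm₂] at hc₂
  have hadd := integral_quadraticIntegrand_add hl (p₁ := inner ℝ e₁ (B η η))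
    (p₂ := inner ℝ e₂ (B η η)) (q₁ := inner ℝ e₁ (B η ξ)) (q₂ := inner ℝ e₂ (B η ξ))
    (r₁ := inner ℝ e₁ (B ξ ξ)) (r₂ := inner ℝ e₂ (B ξ ξ)) (c₁ := inner ℝ e₁ c₀)
    (c₂ := inner ℝ e₂ c₀) (by rw [hc₁]; field_simp; ring) (by rw [hc₂]; field_simp; ring)
    (inner ℝ e₁ (c - c₀)) (inner ℝ e₂ (c - c₀))
  rw [inner_sub_right, inner_sub_right, add_sub_cancel, add_sub_cancel, ← inner_sub_right,
    ← inner_sub_right] at hadd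
  rw [hadd]
  have hne : inner ℝ e₁ (c - c₀) ≠ 0 ∨ inner ℝ e₂ (c - c₀) ≠ 0 := by
    by_contra! hzero
    obtain ⟨E, hE⟩ := exists_frame_isometry he₁ he₂ he
    obtain ⟨w, hw⟩ := E.surjective (c - c₀)
    refine hc (sub_eq_zero.1 ?_)
    rw [← norm_eq_zero, ← sq_eq_zero_iff, ← real_inner_self_eq_norm_sq]
    nth_rw 1 [← hw]
    rw [hE, inner_add_left, inner_smul_left, inner_smul_left, hzero.1, hzero.2]
    simp
  have hpos : 0 < inner ℝ e₂ (c - c₀) ^ 2 * ellipticIntegral 2 0 l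
      + l ^ 2 * inner ℝ e₁ (c - c₀) ^ 2 * ellipticIntegral 0 2 l := by
    rcases hne with h1 | h1 <;> positivity
  have : 0 < (2 * ‖dirDeriv η u x‖)⁻¹ := by positivity
  gcongr
  linarith

end Frame

/-! ### The expansion of the median -/

theorem mainTheorem7 :
    -- the elliptic integrals converge, the quotients are well defined,
    -- and the boundary values of `Q₁`, `Q₂` are their limits
    ((∀ l : ℝ, 0 < l →
        IntegrableOn (ellipticIntegrand 2 2 l) (Metric.closedBall (0 : Plane) 1) ∧
        IntegrableOn (ellipticIntegrand 2 0 l) (Metric.closedBall (0 : Plane) 1) ∧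
        IntegrableOn (ellipticIntegrand 0 4 l) (Metric.closedBall (0 : Plane) 1) ∧
        IntegrableOn (ellipticIntegrand 0 2 l) (Metric.closedBall (0 : Plane) 1) ∧
        0 < ellipticIntegral 2 0 l ∧ 0 < ellipticIntegral 0 2 l) ∧
      Tendsto coeffQ₁ (𝓝[≠] 0) (𝓝 1) ∧ Tendsto coeffQ₂ (𝓝[≠] 0) (𝓝 1) ∧
      Tendsto coeffQ₁ (𝓝[≠] ∞) (𝓝 0) ∧ Tendsto coeffQ₂ (𝓝[≠] ∞) (𝓝 0)) ∧
    -- the approximation result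
    ∀ (Ω : Set Plane) (u : Plane → Plane), IsOpen Ω → ContDiffOn ℝ 2 u Ω →
      ∀ x ∈ Ω, (jacobianMatrix u x).det ≠ 0 →
      ∀ η ξ : Plane, IsMajorMinorEigenframe (structureTensor u x) η ξ →
        (rotationR u η ξ x ∈ Matrix.orthogonalGroup (Fin 2) ℝ ∧
          (rotationR u η ξ x).det =
            Real.sign (jacobianMatrix u x).det * (frameMatrix η ξ).det) ∧
        (∀ᶠ ρ in 𝓝[>] (0 : ℝ), ∃! m : Plane, IsL1MedianOnDisc u x ρ m) ∧
        ∀ M : ℝ → Plane, (∀ᶠ ρ in 𝓝[>] (0 : ℝ), IsL1MedianOnDisc u x ρ (M ρ)) →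
          (fun ρ : ℝ => M ρ - (u x + (ρ ^ 2 / 6) • medianPdeRhs u η ξ x))
            =o[𝓝[>] (0 : ℝ)] (fun ρ : ℝ => ρ ^ 2) := by
  refine ⟨⟨fun l hl => ⟨integrableOn_ellipticIntegrand (by norm_num) hl,
    integrableOn_ellipticIntegrand le_rfl hl, integrableOn_ellipticIntegrand (by norm_num) hl,
    integrableOn_ellipticIntegrand le_rfl hl, ellipticIntegral_20_pos hl,
    ellipticIntegral_02_pos hl⟩, tendsto_coeffQ₁_zero, tendsto_coeffQ₂_zero, tendsto_coeffQ₁_top,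
    tendsto_coeffQ₂_top⟩, ?_⟩
  intro Ω u hΩ huΩ x hx hdet η ξ h
  have hu : ContDiffAt ℝ 2 u x := huΩ.contDiffAt (hΩ.mem_nhds hx)
  have hinj := injective_fderiv_of_det_ne_zero hdet
  have hsurj : Function.Surjective (fderiv ℝ u x) :=
    (LinearMap.injective_iff_surjective (f := (fderiv ℝ u x).toLinearMap)).1 hinj
  refine ⟨⟨?_, h.rotationR_det hdet⟩, ?_, fun M hM => ?_⟩
  · rw [Matrix.mem_orthogonalGroup_iff']
    exact h.rotationR_transpose_mul_self hdet
  · filter_upwards [self_mem_nhdsWithin, eventually_continuousOn_closedBall hu] with ρ hρ hc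
    exact existsUnique_isL1MedianOnDisc hρ hc (hu.differentiableAt (by norm_num)) hsurj
  · have := tendsto_scaled_median hu hinj (fun c hc => h.limitMedianFunctional_lt hu hdet hc) hM
    simpa only [smul_smul, mul_one_div] using this
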